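/- Let $n\ge 2$ and $s\ge 1$ be integers and let $M$ be a non-empty smooth manifold (Hausdorff, second countable, without boundary) of dimension $2n+s$. Let $(f,\xi_1,\dots,\xi_s,\eta^1,\dots,\eta^s,g)$ be an $S$-structure on $M$. That is, $f$ is a smooth $(1,1)$-tensor field, $\xi_\alpha$ are smooth vector fields, $\eta^\alpha$ are smooth 1-forms and $g$ is a Riemannian metric such that $$f^2=-I+\sum_{\alpha=1}^s\eta^\alpha\otimes\xi_\alpha,\quad \eta^\alpha(\xi_\beta)=\delta_{\alpha\beta},\quad f\xi_\alpha=0,\quad \eta^\alpha\circ f=0,$$ $$g(fX,fY)=g(X,Y)-\sum_{\alpha=1}^s\eta^\alpha(X)\eta^\alpha(Y),$$ and, with $\Phi(X,Y)=g(X,fY)$ and $2\,d\eta(X,Y)=X(\eta(Y))-Y(\eta(X))-\eta([X,Y])$, $$[f,f]+2\sum_{\alpha=1}^s d\eta^\alpha\otimes\xi_\alpha=0,\quad \eta^1\wedge\cdots\wedge\eta^s\wedge(d\eta^\alpha)^n\neq 0 \text{ everywhere},\quad \Phi=d\eta^\alpha\qquad(1\le\alpha\le s),$$ where $[f,f](X,Y)=f^2[X,Y]+[fX,fY]-f[fX,Y]-f[X,fY]$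 is the Nijenhuis torsion of $f$. Let $\mathcal L$ be the orthogonal complement of the distribution spanned by $\xi_1,\dots,\xi_s$, and let $K$ be the sectional curvature of the Levi-Civita connection of $g$. Let $c\in\mathbb R$ and suppose that $M$ is an $S$-space-form $M(c)$, i.e. it has constant $f$-sectional curvature $c$: $K(X,fX)=c$ for every unit tangent vector $X\in\mathcal L$. Then the $\mathcal L$-sectional curvature of $M$ is constant equal to $c$ (that is, $K(X,Y)=c$ for all linearly independent $X,Y\in\mathcal L$ at any point of $M$) if and only if $c=s$. Likewise, the $\mathcal L$-sectional curvature is constant, equal to some real number, if and only if $c=s$. -/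

import Mathlib

open scoped ContDiff Manifold

noncomputable section

namespace SGeometry

open Bundle Manifold VectorField FiberBundle

section LeviCivita

variable {E : Type*} [NormedAddCommGroup E] [NormedSpace ℝ E]
  {H : Type*} [TopologicalSpace H] {I : ModelWithCorners ℝ E H}
  {M : Type*} [TopologicalSpace M] [ChartedSpace H M] [IsManifold I ∞ M]
  (g : ContMDiffRiemannianMetric I ∞ E (fun x : M ↦ TangentSpace I x))

theorem mdifferentiableAt_metric {x : M} {X Y : Π x : M, TangentSpace I x}
    (hX : MDiffAt (T% X) x) (hY : MDiffAt (T% Y) x) :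
    MDiffAt (fun y ↦ g.inner y (X y) (Y y)) x := by
  have : MDifferentiableAt I (I.prod 𝓘(ℝ))
      (fun m ↦ TotalSpace.mk' ℝ (E := Bundle.Trivial M ℝ) m (g.inner m (X m) (Y m))) x := by
    apply MDifferentiableAt.clm_bundle_apply₂ (F₁ := E) (F₂ := E)
    · exact g.contMDiff.mdifferentiableAt (by simp)
    · exact hX
    · exact hY
  simp only [mdifferentiableAt_totalSpace] at this
  exact this.2

variable [FiniteDimensional ℝ E]

/-- The right-hand side of the Koszul formula, divided by two, so that
`koszul g X Y Z x = g(∇_X Y, Z)(x)` for the Riemannian connection `∇` of `g`. -/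
def koszul (X Y Z : Π x : M, TangentSpace I x) (x : M) : ℝ :=
  (1 / 2 : ℝ) *
    (mvfderiv I (fun y ↦ g.inner y (Y y) (Z y)) x (X x)
      + mvfderiv I (fun y ↦ g.inner y (Z y) (X y)) x (Y x)
      - mvfderiv I (fun y ↦ g.inner y (X y) (Y y)) x (Z x)
      + g.inner x (mlieBracket I X Y x) (Z x)
      - g.inner x (mlieBracket I X Z x) (Y x)
      - g.inner x (mlieBracket I Y Z x) (X x))

theorem koszul_tensorial_left {x : M} {Y : Π x : M, TangentSpace I x} (hY : MDiffAt (T% Y) x)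
    {Z : Π x : M, TangentSpace I x} (hZ : MDiffAt (T% Z) x) :
    TensorialAt I E (fun X ↦ koszul g X Y Z x) x where
  smul {f X} hf hX := by
    have h1 := mvfderiv_fun_mul hf (mdifferentiableAt_metric g hZ hX)
    have h2 := mvfderiv_fun_mul hf (mdifferentiableAt_metric g hX hY)
    simp [koszul, h1, h2, mlieBracket_smul_left hf hX]
    rw [g.symm x (Z x) (X x)]
    ring
  add {X X'} hX hX' := by
    have h1 := mvfderiv_fun_add (mdifferentiableAt_metric g hZ hX) (mdifferentiableAt_metric g hZ hX')
    have h2 := mvfderiv_fun_add (mdifferentiableAt_metric g hX hY) (mdifferentiableAt_metric g hX' hY)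
    simp [koszul, h1, h2, mlieBracket_add_left hX hX']
    ring

theorem koszul_tensorial_right {x : M} {Y : Π x : M, TangentSpace I x} (hY : MDiffAt (T% Y) x)
    {X : Π x : M, TangentSpace I x} (hX : MDiffAt (T% X) x) :
    TensorialAt I E (fun Z ↦ koszul g X Y Z x) x where
  smul {f Z} hf hZ := by
    have h1 := mvfderiv_fun_mul hf (mdifferentiableAt_metric g hY hZ)
    have h2 := mvfderiv_fun_mul hf (mdifferentiableAt_metric g hZ hX)
    simp [koszul, h1, h2, mlieBracket_smul_right hf hZ]
    rw [g.symm x (Z x) (X x), g.symm x (Z x) (Y x)]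
    ring
  add {Z Z'} hZ hZ' := by
    have h1 := mvfderiv_fun_add (mdifferentiableAt_metric g hY hZ) (mdifferentiableAt_metric g hY hZ')
    have h2 := mvfderiv_fun_add (mdifferentiableAt_metric g hZ hX) (mdifferentiableAt_metric g hZ' hX)
    simp [koszul, h1, h2, mlieBracket_add_right hZ hZ']
    ring

instance finiteDimensional_tangentSpace (x : M) : FiniteDimensional ℝ (TangentSpace I x) :=
  VectorBundle.finiteDimensional ℝ E (fun y : M ↦ TangentSpace I y) x

/-- The musical isomorphism `v ↦ g(v, ·)` of a tangent space onto its dual. -/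
def flat (x : M) : TangentSpace I x ≃ₗ[ℝ] (TangentSpace I x →L[ℝ] ℝ) :=
  have : T2Space (TangentSpace I x) := FiberBundle.t2Space E (fun y : M ↦ TangentSpace I y) x
  LinearMap.linearEquivOfInjective (g.inner x : TangentSpace I x →ₗ[ℝ] TangentSpace I x →L[ℝ] ℝ)
    (by
      rw [injective_iff_map_eq_zero]
      intro v hv
      by_contra h
      have := g.pos x v h
      simp_all)
    (by
      rw [← (LinearMap.toContinuousLinearMap
        (𝕜 := ℝ) (E := TangentSpace I x) (F' := ℝ)).finrank_eq]
      exact (Subspace.dual_finrank_eq (K := ℝ) (V := TangentSpace I x)).symm)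

theorem inner_flat_symm (x : M) (φ : TangentSpace I x →L[ℝ] ℝ) (w : TangentSpace I x) :
    g.inner x ((flat g x).symm φ) w = φ w :=
  congrArg (fun ψ : TangentSpace I x →L[ℝ] ℝ ↦ ψ w) ((flat g x).apply_symm_apply φ)

theorem metric_ext {x : M} {v w : TangentSpace I x}
    (h : ∀ u, g.inner x v u = g.inner x w u) : v = w :=
  (flat g x).injective (ContinuousLinearMap.ext h)

open Classical in
/-- The endomorphism `X ↦ ∇_X Y` of a tangent space, defined by the Koszul formula
(and zero, by convention, where the vector field `Y` is not differentiable). -/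
def leviCivitaFun (Y : Π x : M, TangentSpace I x) (x : M) :
    TangentSpace I x →L[ℝ] TangentSpace I x :=
  have : T2Space (TangentSpace I x) := FiberBundle.t2Space E (fun y : M ↦ TangentSpace I y) x
  if hY : MDiffAt (T% Y) x then
    LinearMap.toContinuousLinearMap
      ((flat g x).symm.toLinearMap ∘ₗ
        (TensorialAt.mkHom₂ (fun X Z ↦ koszul g X Y Z x) x
          (fun _ hZ ↦ koszul_tensorial_left g hY hZ)
          (fun _ hX ↦ koszul_tensorial_right g hY hX)).toLinearMap)
  else 0

theorem inner_leviCivitaFun {x : M} {X Y Z : Π x : M, TangentSpace I x}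
    (hX : MDiffAt (T% X) x) (hY : MDiffAt (T% Y) x) (hZ : MDiffAt (T% Z) x) :
    g.inner x (leviCivitaFun g Y x (X x)) (Z x) = koszul g X Y Z x := by
  simp only [leviCivitaFun, dif_pos hY]
  refine (inner_flat_symm g x _ _).trans ?_
  exact TensorialAt.mkHom₂_apply _ _ hX hZ

theorem leviCivitaFun_ext {x : M} {A B : TangentSpace I x →L[ℝ] TangentSpace I x}
    (h : ∀ X Z : Π x : M, TangentSpace I x, MDiffAt (T% X) x → MDiffAt (T% Z) x →
      g.inner x (A (X x)) (Z x) = g.inner x (B (X x)) (Z x)) : A = B := by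
  ext v
  refine metric_ext g fun w ↦ ?_
  have := h (extend E v) (extend E w) (mdifferentiableAt_extend ..) (mdifferentiableAt_extend ..)
  simpa using this

/-- The Riemannian (Levi-Civita) connection of the metric `g`. -/
def leviCivita : CovariantDerivative I E (fun x : M ↦ TangentSpace I x) where
  toFun := leviCivitaFun g
  isCovariantDerivativeOnUniv :=
    { add := by
        intro Y Y' x hY hY' _
        refine leviCivitaFun_ext g fun X Z hX hZ ↦ ?_
        have h1 := mvfderiv_fun_add (mdifferentiableAt_metric g hY hZ)
          (mdifferentiableAt_metric g hY' hZ)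
        have h2 := mvfderiv_fun_add (mdifferentiableAt_metric g hX hY)
          (mdifferentiableAt_metric g hX hY')
        rw [inner_leviCivitaFun g hX (mdifferentiableAt_add_section hY hY') hZ]
        simp only [_root_.add_apply, map_add]
        rw [inner_leviCivitaFun g hX hY hZ, inner_leviCivitaFun g hX hY' hZ]
        simp [koszul, h1, h2, mlieBracket_add_left hY hY', mlieBracket_add_right hY hY']
        ring
      leibniz := by
        intro Y f x hY hf _
        refine leviCivitaFun_ext g fun X Z hX hZ ↦ ?_
        have h1 := mvfderiv_fun_mul hf (mdifferentiableAt_metric g hY hZ)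
        have h2 := mvfderiv_fun_mul hf (mdifferentiableAt_metric g hX hY)
        rw [inner_leviCivitaFun g hX (hf.smul_section hY) hZ]
        simp only [_root_.add_apply, map_add, _root_.smul_apply,
          map_smul, ContinuousLinearMap.smulRight_apply]
        rw [inner_leviCivitaFun g hX hY hZ]
        simp [koszul, h1, h2, mlieBracket_smul_left hf hY, mlieBracket_smul_right hf hY]
        rw [g.symm x (Y x) (X x)]
        ring }

/-- The Riemannian connection is compatible with the metric. -/
theorem leviCivita_metric {x : M} {X Y Z : Π x : M, TangentSpace I x}
    (hX : MDiffAt (T% X) x) (hY : MDiffAt (T% Y) x) (hZ : MDiffAt (T% Z) x) :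
    mvfderiv I (fun y ↦ g.inner y (Y y) (Z y)) x (X x) =
      g.inner x (leviCivita g Y x (X x)) (Z x) + g.inner x (Y x) (leviCivita g Z x (X x)) := by
  have s (A B : Π x : M, TangentSpace I x) :
      (fun y ↦ g.inner y (A y) (B y)) = fun y ↦ g.inner y (B y) (A y) :=
    funext fun y ↦ g.symm y _ _
  rw [g.symm x (Y x)]
  simp only [leviCivita]
  rw [inner_leviCivitaFun g hX hY hZ, inner_leviCivitaFun g hX hZ hY]
  simp only [koszul]
  rw [s Z Y, s Z X, s Y X, mlieBracket_swap_apply (V := Z) (W := Y), map_neg,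
    _root_.neg_apply]
  ring

/-- The Riemannian connection is symmetric. -/
theorem leviCivita_torsion {x : M} {X Y : Π x : M, TangentSpace I x}
    (hX : MDiffAt (T% X) x) (hY : MDiffAt (T% Y) x) :
    leviCivita g Y x (X x) - leviCivita g X x (Y x) = mlieBracket I X Y x := by
  have s (A B : Π x : M, TangentSpace I x) :
      (fun y ↦ g.inner y (A y) (B y)) = fun y ↦ g.inner y (B y) (A y) :=
    funext fun y ↦ g.symm y _ _
  refine metric_ext g fun w ↦ ?_
  have hZ : MDiffAt (T% (extend E w : Π x : M, TangentSpace I x)) x := mdifferentiableAt_extend ..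
  have hw : (extend E w : Π x : M, TangentSpace I x) x = w := by simp
  rw [← hw]
  simp only [leviCivita, map_sub, _root_.sub_apply]
  rw [inner_leviCivitaFun g hX hY hZ, inner_leviCivitaFun g hY hX hZ]
  simp only [koszul]
  rw [s X (extend E w), s (extend E w) Y, s Y X, mlieBracket_swap_apply (V := Y) (W := X), map_neg,
    _root_.neg_apply]
  ring

/-- The curvature operator `R(X, Y)Z = ∇_X ∇_Y Z - ∇_Y ∇_X Z - ∇_[X, Y] Z` of a linear
connection. -/
def curvature (nabla : CovariantDerivative I E (fun x : M ↦ TangentSpace I x))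
    (X Y Z : Π x : M, TangentSpace I x) (x : M) : TangentSpace I x :=
  nabla (fun y ↦ nabla Z y (Y y)) x (X x) - nabla (fun y ↦ nabla Z y (X y)) x (Y x)
    - nabla Z x (mlieBracket I X Y x)

/-- The sectional curvature `K(X, Y)` of the Riemannian connection of `g`, as a function on `M`;
it is meaningful at the points where `X` and `Y` are linearly independent. -/
def sectionalCurvature (X Y : Π x : M, TangentSpace I x) (x : M) : ℝ :=
  g.inner x (curvature (leviCivita g) X Y Y x) (X x) /
    (g.inner x (X x) (X x) * g.inner x (Y x) (Y x) - g.inner x (X x) (Y x) ^ 2)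

end LeviCivita

section Structures

variable {E : Type*} [NormedAddCommGroup E] [NormedSpace ℝ E]
  {H : Type*} [TopologicalSpace H]

/-- A metric `f`-structure `(f, ξ_1, …, ξ_s, η^1, …, η^s, g)` on a manifold `M`. -/
structure MetricFStructure (s : ℕ) (I : ModelWithCorners ℝ E H)
    (M : Type*) [TopologicalSpace M] [ChartedSpace H M] [IsManifold I ∞ M] where
  /-- The Riemannian metric. -/
  g : ContMDiffRiemannianMetric I ∞ E (fun x : M ↦ TangentSpace I x)
  /-- The tensor field of type `(1,1)`. -/
  f : Π x : M, TangentSpace I x →L[ℝ] TangentSpace I x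
  /-- The structure vector fields. -/
  ξ : Fin s → Π x : M, TangentSpace I x
  /-- The structure 1-forms. -/
  η : Fin s → Π x : M, TangentSpace I x →L[ℝ] ℝ
  contMDiff_f : ContMDiff I (I.prod 𝓘(ℝ, E →L[ℝ] E)) ∞
    (fun x ↦ TotalSpace.mk' (E →L[ℝ] E)
      (E := fun x : M ↦ TangentSpace I x →L[ℝ] TangentSpace I x) x (f x))
  contMDiff_ξ : ∀ α, ContMDiff I I.tangent ∞ (fun x ↦ (⟨x, ξ α x⟩ : TangentBundle I M))
  contMDiff_η : ∀ α, ContMDiff I (I.prod 𝓘(ℝ, E →L[ℝ] ℝ)) ∞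
    (fun x ↦ TotalSpace.mk' (E →L[ℝ] ℝ)
      (E := fun x : M ↦ TangentSpace I x →L[ℝ] Bundle.Trivial M ℝ x) x (η α x))
  f_sq : ∀ x (v : TangentSpace I x), f x (f x v) = -v + ∑ α, η α x v • ξ α x
  η_ξ : ∀ α β x, η α x (ξ β x) = if α = β then 1 else 0
  f_ξ : ∀ α x, f x (ξ α x) = 0
  η_f : ∀ α x (v : TangentSpace I x), η α x (f x v) = 0
  metric_f : ∀ x (v w : TangentSpace I x),
    g.inner x (f x v) (f x w) = g.inner x v w - ∑ α, η α x v * η α x w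

variable {I : ModelWithCorners ℝ E H}
  {M : Type*} [TopologicalSpace M] [ChartedSpace H M] [IsManifold I ∞ M]

/-- Smooth vector fields on `M`. -/
def IsSmoothField (X : Π x : M, TangentSpace I x) : Prop :=
  ContMDiff I I.tangent ∞ (fun x ↦ (⟨x, X x⟩ : TangentBundle I M))

/-- The exterior derivative of a 1-form, with the normalization
`2 dθ(X, Y) = X(θ(Y)) - Y(θ(X)) - θ([X, Y])` that is used for metric contact structures. -/
def extDerivOneForm (θ : Π x : M, TangentSpace I x →L[ℝ] ℝ)
    (X Y : Π x : M, TangentSpace I x) (x : M) : ℝ :=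
  (1 / 2 : ℝ) *
    (mvfderiv I (fun y ↦ θ y (Y y)) x (X x) - mvfderiv I (fun y ↦ θ y (X y)) x (Y x)
      - θ x (mlieBracket I X Y x))

/-- The Nijenhuis torsion `[f, f]` of a tensor field of type `(1,1)`. -/
def nijenhuis (f : Π x : M, TangentSpace I x →L[ℝ] TangentSpace I x)
    (X Y : Π x : M, TangentSpace I x) (x : M) : TangentSpace I x :=
  f x (f x (mlieBracket I X Y x))
    + mlieBracket I (fun y ↦ f y (X y)) (fun y ↦ f y (Y y)) x
    - f x (mlieBracket I (fun y ↦ f y (X y)) Y x)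
    - f x (mlieBracket I X (fun y ↦ f y (Y y)) x)

namespace MetricFStructure

variable {s : ℕ} (S : MetricFStructure s I M)

/-- The fundamental 2-form `Φ(X, Y) = g(X, fY)`. -/
def fundamentalForm (x : M) (v w : TangentSpace I x) : ℝ := S.g.inner x v (S.f x w)

/-- The fibre at `x` of the distribution `𝓛`, the orthogonal complement of the span of the
structure vector fields. -/
def distL (x : M) : Submodule ℝ (TangentSpace I x) where
  carrier := {v | ∀ α, S.g.inner x v (S.ξ α x) = 0}
  zero_mem' := by intro α; simp
  add_mem' := by
    intro v w hv hw α
    simp [hv α, hw α]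
  smul_mem' := by
    intro c v hv α
    simp [hv α]

/-- Up to a nonzero constant factor, the value of the form
`η^1 ∧ ⋯ ∧ η^s ∧ (dη^α)^n` at `x` on `s + 2n` vector fields: the antisymmetrization of
`η^1 ⊗ ⋯ ⊗ η^s ⊗ dη^α ⊗ ⋯ ⊗ dη^α`. -/
def volumeForm (n : ℕ) (α : Fin s)
    (V : Fin s ⊕ (Fin n × Fin 2) → Π x : M, TangentSpace I x) (x : M) : ℝ :=
  ∑ σ : Equiv.Perm (Fin s ⊕ (Fin n × Fin 2)), ((Equiv.Perm.sign σ : ℤ) : ℝ) *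
    ((∏ β : Fin s, S.η β x (V (σ (Sum.inl β)) x)) *
      ∏ i : Fin n, extDerivOneForm (S.η α) (V (σ (Sum.inr (i, 0)))) (V (σ (Sum.inr (i, 1)))) x)

/-- A metric `f`-structure on a `(2n+s)`-dimensional manifold is an `S`-structure if it is normal,
`η^1 ∧ ⋯ ∧ η^s ∧ (dη^α)^n` vanishes nowhere, and `Φ = dη^α` for every `α`. -/
structure IsSStructure (n : ℕ) : Prop where
  normal : ∀ X Y : Π x : M, TangentSpace I x, IsSmoothField X → IsSmoothField Y → ∀ x,
    nijenhuis S.f X Y x + (2 : ℝ) • ∑ α, extDerivOneForm (S.η α) X Y x • S.ξ α x = 0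
  volumeForm_ne_zero : ∀ α x, ∃ V : Fin s ⊕ (Fin n × Fin 2) → Π x : M, TangentSpace I x,
    (∀ i, IsSmoothField (V i)) ∧ S.volumeForm n α V x ≠ 0
  fundamentalForm_eq : ∀ α, ∀ X Y : Π x : M, TangentSpace I x,
    IsSmoothField X → IsSmoothField Y → ∀ x,
    S.fundamentalForm x (X x) (Y x) = extDerivOneForm (S.η α) X Y x

variable [FiniteDimensional ℝ E]

/-- All `f`-sectional curvatures, that is, the sectional curvatures of the planes spanned by a unit
vector `X` of `𝓛` and `fX`, are equal to `c`. -/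
def HasConstantFSectionalCurvature (c : ℝ) : Prop :=
  ∀ X : Π x : M, TangentSpace I x, IsSmoothField X → ∀ x, X x ∈ S.distL x →
    S.g.inner x (X x) (X x) = 1 → sectionalCurvature S.g X (fun y ↦ S.f y (X y)) x = c

/-- All `𝓛`-sectional curvatures, that is, the sectional curvatures of the planes spanned by two
vectors of `𝓛`, are equal to `c`. -/
def HasConstantLSectionalCurvature (c : ℝ) : Prop :=
  ∀ X Y : Π x : M, TangentSpace I x, IsSmoothField X → IsSmoothField Y → ∀ x,
    X x ∈ S.distL x → Y x ∈ S.distL x → LinearIndependent ℝ ![X x, Y x] →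
    sectionalCurvature S.g X Y x = c

end MetricFStructure

end Structures

end SGeometry

end

/-! On an S-manifold each ξ_α is a Killing field with ∇_X ξ_α = -fX, and the geometry transverse to
these fields is Kähler: with ξ̄ = Σ ξ_α one has (∇_X f)Y = g(fX, fY) ξ̄ + g(Y, ξ̄) f²X
(`nablaF_eq`). Differentiating once more (`curv_f`) shows that on 𝓛 the curvature tensor fails to be
f-invariant exactly as much as s times the tensor of constant curvature 1 does. The difference
`curvDiff` is therefore an algebraic Kähler curvature tensor on 𝓛, and its holomorphic sectional
curvature is c - s.

A Kähler curvature tensor is determined by its holomorphic sectional curvature (`sectional_of_hol`),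
so on 𝓛 4 R(X,Y,Y,X) = (c + 3s)(|X|²|Y|² - g(X,Y)²) + 3(c - s) g(X,fY)² (`four_mul_curv`). If c = s,
the last term drops out and every plane in 𝓛 has curvature c. Conversely, let all these curvatures
equal k. The plane of X and fX gives k = c; a plane spanned by X and some Y orthogonal to X and fX,
which exists because n ≥ 2, gives 4k = c + 3s. Hence c = s.

The tensor calculus is done in the module of smooth vector fields over the ring of smooth functions
(`RiemannianAlgebra`, `SAlgebra`); a point enters as a ring homomorphism ε to ℝ. -/

namespace SGeometry

/-! ### Algebraic Kähler curvature tensors and polarization -/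

section Polarization

variable {W : Type*} [AddCommGroup W]

/-- The algebraic symmetries of the curvature tensor of a Kähler manifold with complex
structure `J`. -/
structure IsKaehlerCurvature (J : W →+ W) (T : W → W → W → W → ℝ) : Prop where
  J_sq : ∀ X, J (J X) = -X
  add_left : ∀ X X' Y Z U, T (X + X') Y Z U = T X Y Z U + T X' Y Z U
  skew : ∀ X Y Z U, T X Y Z U = -T Y X Z U
  skew' : ∀ X Y Z U, T X Y Z U = -T X Y U Z
  bianchi : ∀ X Y Z U, T X Y Z U + T Y Z X U + T Z X Y U = 0
  J_inv : ∀ X Y Z U, T X Y (J Z) (J U) = T X Y Z U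

namespace IsKaehlerCurvature

variable {J : W →+ W} {T : W → W → W → W → ℝ}

/-- The classical octahedron argument: combine the Bianchi identities of the four cyclic
arrangements of X, Y, Z, U, using skewness in each pair. -/
theorem pair_symm (h : IsKaehlerCurvature J T) (X Y Z U : W) : T X Y Z U = T Z U X Y := by
  linarith [h.bianchi X Y Z U, h.bianchi Y Z U X, h.bianchi Z U X Y, h.bianchi U X Y Z,
    h.skew X Y Z U, h.skew' Y Z U X, h.skew' Z X Y U, h.skew U X Y Z, h.skew' X Y Z U,
    h.skew Y Z U X, h.skew Z U X Y, h.skew' Z U X Y, h.skew' U X Y Z, h.skew Z X Y U,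
    h.skew' Y Z X U, h.skew' X Z Y U, h.skew X Z Y U, h.skew' Y U Z X, h.skew Y U Z X,
    h.skew U Y Z X, h.skew U Y X Z]

theorem add_two (h : IsKaehlerCurvature J T) (X Y Y' Z U : W) :
    T X (Y + Y') Z U = T X Y Z U + T X Y' Z U := by
  rw [h.skew, h.add_left, h.skew Y, h.skew Y']; ring

theorem add_three (h : IsKaehlerCurvature J T) (X Y Z Z' U : W) :
    T X Y (Z + Z') U = T X Y Z U + T X Y Z' U := by
  rw [h.pair_symm, h.add_left, h.pair_symm Z, h.pair_symm Z']

theorem add_four (h : IsKaehlerCurvature J T) (X Y Z U U' : W) :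
    T X Y Z (U + U') = T X Y Z U + T X Y Z U' := by
  rw [h.skew', h.add_three, h.skew' X Y U, h.skew' X Y U']; ring

theorem neg_three (h : IsKaehlerCurvature J T) (X Y Z U : W) : T X Y (-Z) U = -T X Y Z U := by
  have h0 := h.add_three X Y 0 0 U
  have h1 := h.add_three X Y Z (-Z) U
  simp only [add_zero, add_neg_cancel] at h0 h1
  linarith

theorem J_three (h : IsKaehlerCurvature J T) (X Y Z U : W) : T X Y (J Z) U = -T X Y Z (J U) := by
  have h0 := h.J_inv X Y (J Z) U
  rw [h.J_sq, h.neg_three] at h0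
  linarith

theorem neg_four (h : IsKaehlerCurvature J T) (X Y Z U : W) : T X Y Z (-U) = -T X Y Z U := by
  rw [h.skew', h.neg_three, ← h.skew']

theorem neg_one (h : IsKaehlerCurvature J T) (X Y Z U : W) : T (-X) Y Z U = -T X Y Z U := by
  rw [h.pair_symm, h.neg_three, ← h.pair_symm]

theorem neg_two (h : IsKaehlerCurvature J T) (X Y Z U : W) : T X (-Y) Z U = -T X Y Z U := by
  rw [h.pair_symm, h.neg_four, ← h.pair_symm]

theorem J_one (h : IsKaehlerCurvature J T) (X Y Z U : W) : T (J X) Y Z U = -T X (J Y) Z U := by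
  rw [h.pair_symm, h.J_three, ← h.pair_symm]

/-- The holomorphic sectional curvature (of a vector of any length) of a sum. -/
theorem hol_add (h : IsKaehlerCurvature J T) (X Y : W) :
    T (X + Y) (J (X + Y)) (J (X + Y)) (X + Y) =
      T X (J X) (J X) X + T Y (J Y) (J Y) Y + 2 * T X (J X) (J Y) Y + 4 * T X (J Y) (J Y) X
        + 4 * T X (J X) (J Y) X + 4 * T Y (J Y) (J X) Y := by
  -- Since J is skew and T alternates, A and B may be exchanged; together with pair symmetry this
  -- collects the sixteen terms of the expansion.
  have e (A B Z U : W) : T A (J B) Z U = T B (J A) Z U := by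
    rw [h.skew A, h.J_one]; ring
  have e' (A B Z U : W) : T Z U (J B) A = T Z U (J A) B := by
    rw [h.skew' Z U (J A), h.J_three, ← h.skew']
  simp only [map_add, h.add_left, h.add_two, h.add_three, h.add_four]
  linarith [e Y X (J X) X, e Y X (J Y) X, e Y X (J X) Y, e Y X (J Y) Y, e' Y X X (J X),
    e' Y X X (J Y), e' Y X Y (J Y), e' Y X Y (J X), h.pair_symm Y (J Y) (J X) X,
    h.skew' Y (J Y) (J X) X, h.skew' X (J X) (J Y) Y, h.pair_symm X (J X) (J Y) Y,
    h.skew Y (J Y) (J X) X, h.skew (J Y) Y (J X) X, h.skew' (J Y) Y X (J X),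
    h.skew X (J Y) (J X) X, h.skew' X (J Y) (J X) X, h.pair_symm X (J X) (J Y) X,
    h.skew (J X) X X (J Y), h.skew' (J X) X X (J Y), h.pair_symm X (J Y) (J X) X,
    h.skew (J X) X (J Y) X, h.pair_symm Y (J Y) (J X) Y, h.pair_symm X (J Y) (J Y) Y,
    h.skew' (J Y) Y X (J Y), h.skew (J Y) Y X (J Y), h.skew Y (J Y) X (J Y),
    h.skew' Y (J Y) X (J Y)]

/-- Polarization: the sectional curvature in terms of the holomorphic sectional curvature. -/
theorem sectional_eq_hol (h : IsKaehlerCurvature J T) (X Y : W) :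
    32 * T X Y Y X =
      3 * T (X + J Y) (J (X + J Y)) (J (X + J Y)) (X + J Y)
        + 3 * T (X + -J Y) (J (X + -J Y)) (J (X + -J Y)) (X + -J Y)
        - T (X + Y) (J (X + Y)) (J (X + Y)) (X + Y)
        - T (X + -Y) (J (X + -Y)) (J (X + -Y)) (X + -Y)
        - 4 * T X (J X) (J X) X - 4 * T Y (J Y) (J Y) Y := by
  -- Bianchi and J-invariance trade the mixed term for two sectional terms.
  have e1 : T X (J X) Y (J Y) = T X (J Y) X (J Y) + T X Y X Y := by
    have := h.bianchi X (J X) Y (J Y)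
    have h1 := h.J_one X Y X (J Y)
    have h2 : T (J X) Y X (J Y) = T (J Y) X X (J Y) := by rw [h.J_one, h.skew]; ring
    have h3 : T Y X (J X) (J Y) = T Y X X Y := h.J_inv Y X X Y
    linarith [h.skew (J Y) X X (J Y), h.skew' Y X X Y, h.skew Y X Y X, h.skew' X Y Y X,
      h.skew Y X X Y]
  -- Adding the values at Y and -Y removes the terms odd in Y. The weights 3 and -1 make the terms
  -- `T X (J Y) (J Y) X` cancel once `e1` is used.
  rw [h.hol_add X (J Y), h.hol_add X (-J Y), h.hol_add X Y, h.hol_add X (-Y)]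
  simp only [map_neg, h.J_sq, h.neg_one, h.neg_two, h.neg_three, h.neg_four, neg_neg]
  linarith [h.skew' X (J X) Y (J Y), h.skew' X (J X) (J Y) Y, h.skew' X Y Y X,
    h.skew' X (J Y) (J Y) X, h.skew' (J Y) Y Y (J Y), h.skew (J Y) Y Y (J Y),
    h.skew Y (J Y) Y (J Y),
    h.skew' Y (J Y) Y (J Y)]

/-- A Kähler curvature tensor whose holomorphic sectional curvature is a constant `k`. -/
theorem sectional_of_hol (h : IsKaehlerCurvature J T) {q : W → W → ℝ}
    (q_add : ∀ X X' Y, q (X + X') Y = q X Y + q X' Y)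
    (q_symm : ∀ X Y, q X Y = q Y X) (q_J : ∀ X Y, q (J X) (J Y) = q X Y)
    (q_zero : ∀ X, q X X = 0 → ∀ Y, q X Y = 0) {k : ℝ}
    (hk : ∀ X, q X X ≠ 0 → T X (J X) (J X) X = k * q X X ^ 2) (X Y : W) (hX : q X X ≠ 0) :
    4 * T X Y Y X = k * (q X X * q Y Y - q X Y ^ 2 + 3 * q X (J Y) ^ 2) := by
  have q_add' (X Y Y' : W) : q X (Y + Y') = q X Y + q X Y' := by
    rw [q_symm, q_add, q_symm Y, q_symm Y']
  have q_neg (X Y : W) : q (-X) Y = -q X Y := by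
    have h0 := q_add 0 0 Y
    have h1 := q_add X (-X) Y
    simp only [add_zero, add_neg_cancel] at h0 h1
    linarith
  have q_neg' (X Y : W) : q X (-Y) = -q X Y := by rw [q_symm, q_neg, q_symm Y]
  -- In the application Z is a field and q its squared length at one point, so q is only
  -- semidefinite and `hk` is silent about fields vanishing there.
  have H (Z : W) : T Z (J Z) (J Z) Z = k * q Z Z ^ 2 := by
    by_cases hZ : q Z Z = 0
    · have hZX := q_zero Z hZ X
      have hXZ : q X Z = 0 := by rw [q_symm, hZX]
      -- For null Z the holomorphic curvature at Z + tX is a quartic polynomial in t. Its values at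
      -- t = ±1, ±2 and its leading coefficient `a5` force the constant term to be zero.
      have a1 := hk (Z + X) (by simpa [q_add, q_add', hZ, hZX, hXZ] using hX)
      have a2 := hk (Z + -X) (by simpa [q_add, q_add', q_neg, q_neg', hZ, hZX, hXZ] using hX)
      have a3 := hk (Z + (X + X)) (by
        simp only [q_add, q_add', hZ, hZX, hXZ]; intro h0; apply hX; linarith)
      have a4 := hk (Z + -(X + X)) (by
        simp only [q_add, q_add', q_neg, q_neg', hZ, hZX, hXZ]; intro h0; apply hX; linarith)
      have a5 := hk X hX
      rw [h.hol_add] at a1 a2 a3 a4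
      simp only [map_add, map_neg, h.add_left, h.add_two, h.add_three, h.add_four, h.neg_one,
        h.neg_two, h.neg_three, h.neg_four, q_add, q_add', q_neg, q_neg', hZ, hZX, hXZ]
        at a1 a2 a3 a4 a5 ⊢
      linarith
    · exact hk Z hZ
  have e1 : q (J Y) X = q X (J Y) := q_symm _ _
  have e2 : q Y X = q X Y := q_symm _ _
  have := h.sectional_eq_hol X Y
  simp only [H] at this
  simp only [q_add, q_add', q_neg, q_neg', q_J, e1, e2] at this
  linarith

end IsKaehlerCurvature
end Polarization
end SGeometry

namespace SGeometry

/-! ### Riemannian calculus over the ring of functions -/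

section Algebra

/-- The algebraic structure that a Riemannian metric and its Levi-Civita connection induce on the
module `V` of vector fields over the ring `C` of smooth functions. -/
structure RiemannianAlgebra (C V : Type*) [CommRing C] [AddCommGroup V] [Module C V] where
  /-- The derivative of a function along a vector field. -/
  act : V →ₗ[C] C →+ C
  /-- The Riemannian metric. -/
  met : V →ₗ[C] V →ₗ[C] C
  /-- The covariant derivative `∇_X Y`. -/
  nabla : V →ₗ[C] V →+ V
  /-- The Lie bracket. -/
  br : V → V → V
  act_mul : ∀ X a b, act X (a * b) = act X a * b + a * act X b
  met_symm : ∀ X Y, met X Y = met Y X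
  met_nondeg : ∀ X, (∀ Y, met X Y = 0) → X = 0
  nabla_smul : ∀ X a Y, nabla X (a • Y) = act X a • Y + a • nabla X Y
  act_met : ∀ X Y Z, act X (met Y Z) = met (nabla X Y) Z + met Y (nabla X Z)
  br_eq : ∀ X Y, br X Y = nabla X Y - nabla Y X
  jacobi : ∀ X Y Z, br X (br Y Z) = br (br X Y) Z + br Y (br X Z)
  act_br : ∀ X Y a, act (br X Y) a = act X (act Y a) - act Y (act X a)

namespace RiemannianAlgebra

variable {C V : Type*} [CommRing C] [AddCommGroup V] [Module C V] (D : RiemannianAlgebra C V)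

theorem met_ext {X X' : V} (h : ∀ Y, D.met X Y = D.met X' Y) : X = X' :=
  sub_eq_zero.1 (D.met_nondeg _ fun Y ↦ by simp [h Y])

theorem act_one (X : V) : D.act X 1 = 0 := by
  have := D.act_mul X 1 1
  simpa using this

theorem br_skew (X Y : V) : D.br X Y = -D.br Y X := by
  rw [D.br_eq, D.br_eq]; abel

theorem br_add_left (X X' Y : V) : D.br (X + X') Y = D.br X Y + D.br X' Y := by
  simp only [D.br_eq, map_add, AddMonoidHom.add_apply]; abel

theorem br_smul_left (a : C) (X Y : V) : D.br (a • X) Y = a • D.br X Y - D.act Y a • X := by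
  simp only [D.br_eq, map_smul, D.nabla_smul, AddMonoidHom.smul_apply]
  module

theorem br_add_right (X Y Y' : V) : D.br X (Y + Y') = D.br X Y + D.br X Y' := by
  simp only [D.br_eq, map_add, AddMonoidHom.add_apply]; abel

theorem br_smul_right (a : C) (X Y : V) : D.br X (a • Y) = a • D.br X Y + D.act X a • Y := by
  rw [D.br_skew, D.br_smul_left, D.br_skew Y]; module

/-- The Riemannian curvature tensor `R(X, Y, Z, U) = g(R(X, Y)Z, U)`. -/
def curv (X Y Z U : V) : C :=
  D.met (D.nabla X (D.nabla Y Z) - D.nabla Y (D.nabla X Z) - D.nabla (D.br X Y) Z) U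

theorem curv_skew (X Y Z U : V) : D.curv X Y Z U = -D.curv Y X Z U := by
  rw [curv, curv, D.br_skew Y X, ← LinearMap.neg_apply, ← map_neg]
  congr 2
  simp only [map_neg, AddMonoidHom.neg_apply]
  abel

/-- Let [X, Y] act on the function g(Z, U) and expand by metric compatibility. -/
theorem curv_skew' (X Y Z U : V) : D.curv X Y Z U = -D.curv X Y U Z := by
  have h := D.act_br X Y (D.met Z U)
  simp only [D.act_met, map_add] at h
  simp only [curv, map_sub, LinearMap.sub_apply]
  rw [D.met_symm _ Z, D.met_symm _ Z, D.met_symm _ Z]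
  linear_combination -h

theorem curv_add_left (X X' Y Z U : V) :
    D.curv (X + X') Y Z U = D.curv X Y Z U + D.curv X' Y Z U := by
  simp only [curv, map_add, D.br_add_left, AddMonoidHom.add_apply, map_sub, LinearMap.sub_apply,
    LinearMap.add_apply]
  ring

theorem curv_smul_left (a : C) (X Y Z U : V) : D.curv (a • X) Y Z U = a * D.curv X Y Z U := by
  simp only [curv, map_smul, D.br_smul_left, AddMonoidHom.smul_apply, map_sub, LinearMap.sub_apply,
    LinearMap.smul_apply, D.nabla_smul, map_add, LinearMap.add_apply, smul_eq_mul,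
    AddMonoidHom.sub_apply]
  ring

theorem curv_smul_two (a : C) (X Y Z U : V) : D.curv X (a • Y) Z U = a * D.curv X Y Z U := by
  rw [D.curv_skew, D.curv_smul_left, D.curv_skew Y]; ring

theorem curv_smul_four (a : C) (X Y Z U : V) : D.curv X Y Z (a • U) = a * D.curv X Y Z U :=
  map_smul _ _ _

theorem curv_smul_three (a : C) (X Y Z U : V) : D.curv X Y (a • Z) U = a * D.curv X Y Z U := by
  rw [D.curv_skew', D.curv_smul_four, D.curv_skew' X Y U]; ring

theorem curv_bianchi (X Y Z U : V) :
    D.curv X Y Z U + D.curv Y Z X U + D.curv Z X Y U = 0 := by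
  have h := D.jacobi X Y Z
  have e (A B C : V) :
      D.nabla A (D.br B C) = D.nabla A (D.nabla B C) - D.nabla A (D.nabla C B) := by
    rw [D.br_eq, map_sub]
  rw [D.br_skew X Z, D.br_eq X (D.br Y Z), D.br_eq (D.br X Y) Z, D.br_eq Y (-_), e, e, map_neg,
    map_neg, AddMonoidHom.neg_apply, e] at h
  simp only [curv, ← LinearMap.add_apply, ← map_add]
  refine (congrArg (fun A ↦ D.met A U) (?_ : _ = (0 : V))).trans (by simp)
  linear_combination (norm := module) h

end RiemannianAlgebra

/-! ### S-structures: Lie derivatives along the structure fields -/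

/-- The algebraic structure that an `S`-structure induces on vector fields. -/
structure SAlgebra (s : ℕ) (C V : Type*) [CommRing C] [AddCommGroup V] [Module C V] extends
    RiemannianAlgebra C V where
  /-- The tensor field of type `(1,1)`. -/
  f : V →ₗ[C] V
  /-- The structure vector fields. -/
  ξ : Fin s → V
  f_sq : ∀ X, f (f X) = -X + ∑ α, met X (ξ α) • ξ α
  met_ξ : ∀ α β, met (ξ α) (ξ β) = if α = β then 1 else 0
  f_ξ : ∀ α, f (ξ α) = 0
  met_f_ξ : ∀ α X, met (f X) (ξ α) = 0
  met_f : ∀ X Y, met (f X) (f Y) = met X Y - ∑ α, met X (ξ α) * met Y (ξ α)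
  normal : ∀ X Y, f (f (br X Y)) + br (f X) (f Y) - f (br (f X) Y) - f (br X (f Y))
    + ∑ α, (2 * met X (f Y)) • ξ α = 0
  contact : ∀ α X Y, 2 * met X (f Y) =
    act X (met Y (ξ α)) - act Y (met X (ξ α)) - met (br X Y) (ξ α)

namespace SAlgebra

variable {s : ℕ} {C V : Type*} [CommRing C] [AddCommGroup V] [Module C V] (D : SAlgebra s C V)

theorem two_cancel {C : Type*} [CommRing C] [Algebra ℝ C] {a : C} (h : 2 * a = 0) : a = 0 := by
  have h2 : algebraMap ℝ C (1 / 2) * 2 = 1 := by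
    rw [← map_ofNat (algebraMap ℝ C) 2, ← map_mul]; norm_num
  linear_combination algebraMap ℝ C (1 / 2) * h - a * h2

/-- Metric compatibility for X and fY: the η-terms vanish on the image of f. -/
theorem met_f_left (X Y : V) : D.met (D.f X) Y = -D.met X (D.f Y) := by
  have h := D.met_f X (D.f Y)
  simp only [D.f_sq, map_add, map_neg, map_sum, map_smul, D.met_f_ξ, smul_zero, mul_zero,
    Finset.sum_const_zero] at h
  linear_combination -h

theorem decomp (X : V) : X = -D.f (D.f X) + ∑ α, D.met X (D.ξ α) • D.ξ α := by
  rw [D.f_sq]; abel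

theorem met_ξ_f (α : Fin s) (X : V) : D.met (D.ξ α) (D.f X) = 0 := by
  rw [D.met_symm, D.met_f_ξ]

theorem act_met_ξ (X : V) (α β : Fin s) : D.act X (D.met (D.ξ α) (D.ξ β)) = 0 := by
  rw [D.met_ξ]; split_ifs
  · exact D.act_one X
  · exact map_zero _

theorem br_zero_left (X : V) : D.br 0 X = 0 := by simp [D.br_eq]

theorem br_zero_right (X : V) : D.br X 0 = 0 := by simp [D.br_eq]

theorem eq_zero_of_f_eq_zero {X : V} (h : D.f X = 0) (h' : ∀ α, D.met X (D.ξ α) = 0) : X = 0 := by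
  rw [D.decomp X]; simp [h, h']

/-- This is L_{ξ_α} η^β = 0: in the contact identity Φ(ξ_α, ·) = 0 and g(ξ_α, ξ_β) is constant. -/
theorem met_ξ_br (α β : Fin s) (X : V) :
    D.met (D.br (D.ξ α) X) (D.ξ β) = D.act (D.ξ α) (D.met X (D.ξ β)) := by
  have h := D.contact β (D.ξ α) X
  rw [D.met_ξ_f, D.act_met_ξ] at h
  linear_combination h

/-- This is L_{ξ_α} f = 0. Normality at ξ_α only shows that f kills the difference; the ξ-components
come from `met_ξ_br`. -/
theorem ξ_br_f (α : Fin s) (X : V) : D.br (D.ξ α) (D.f X) = D.f (D.br (D.ξ α) X) := by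
  refine sub_eq_zero.1 (D.eq_zero_of_f_eq_zero ?_ fun β ↦ ?_)
  · have h := D.normal (D.ξ α) X
    simp only [D.f_ξ, D.br_zero_left, D.met_ξ_f, mul_zero, zero_smul, Finset.sum_const_zero,
      add_zero, map_zero, sub_zero] at h
    rw [map_sub, ← neg_sub, h, neg_zero]
  · simp [D.met_ξ_br, D.met_f_ξ]

theorem ξ_br_ξ (α β : Fin s) : D.br (D.ξ α) (D.ξ β) = 0 := by
  refine D.eq_zero_of_f_eq_zero ?_ fun γ ↦ ?_
  · rw [← D.ξ_br_f, D.f_ξ, D.br_zero_right]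
  · rw [D.met_ξ_br, D.act_met_ξ]

theorem act_two_mul (X : V) (a : C) : D.act X (2 * a) = 2 * D.act X a := by
  rw [two_mul, two_mul, map_add]

/-- The covariant derivative `(∇_X f) Y`. -/
def nablaF : V →ₗ[C] V →ₗ[C] V :=
  LinearMap.mk₂ C (fun X Y ↦ D.nabla X (D.f Y) - D.f (D.nabla X Y))
    (fun X X' Y ↦ by simp only [map_add, AddMonoidHom.add_apply]; abel)
    (fun a X Y ↦ by simp only [map_smul, AddMonoidHom.smul_apply]; module)
    (fun X Y Y' ↦ by simp only [map_add]; abel)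
    (fun a X Y ↦ by simp only [map_smul, D.nabla_smul, map_add]; module)

theorem nabla_f (X Y : V) : D.nabla X (D.f Y) = D.nablaF X Y + D.f (D.nabla X Y) := by
  simp [nablaF]

/-- The distribution `𝓛`. -/
def distL : Submodule C V where
  carrier := {X | ∀ α, D.met X (D.ξ α) = 0}
  zero_mem' := by simp
  add_mem' hX hY α := by simp [hX α, hY α]
  smul_mem' a X hX α := by simp [hX α]

variable {D}

theorem f_mem_distL (X : V) : D.f X ∈ D.distL := fun α ↦ D.met_f_ξ α X

theorem f_f_of_mem {X : V} (hX : X ∈ D.distL) : D.f (D.f X) = -X := by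
  rw [D.f_sq, Finset.sum_eq_zero fun α _ ↦ by rw [hX α, zero_smul], add_zero]

theorem met_f_of_mem {X : V} (hX : X ∈ D.distL) (Y : V) : D.met (D.f Y) (D.f X) = D.met Y X := by
  rw [D.met_f, Finset.sum_eq_zero fun α _ ↦ by rw [hX α, mul_zero], sub_zero]

/-- The sum of the structure vector fields. -/
def xiSum (D : SAlgebra s C V) : V := ∑ α, D.ξ α

theorem met_xiSum_of_mem {X : V} (hX : X ∈ D.distL) : D.met X D.xiSum = 0 := by
  rw [xiSum, map_sum, Finset.sum_eq_zero fun α _ ↦ hX α]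

theorem met_ξ_xiSum (α : Fin s) : D.met (D.ξ α) D.xiSum = 1 := by
  simp [xiSum, D.met_ξ]

theorem met_ext_distL {X X' : V} (h : ∀ Y ∈ D.distL, D.met X Y = D.met X' Y)
    (h' : ∀ α, D.met X (D.ξ α) = D.met X' (D.ξ α)) : X = X' := by
  refine D.met_ext fun Y ↦ ?_
  rw [D.decomp Y, ← map_neg D.f]
  simp only [map_add, map_sum, map_smul, h', h _ (f_mem_distL _)]

/-- The value at a point of a tensor on fields of `𝓛` at that point depends only on their
horizontal parts. -/
theorem eval_horizontal (ε : C →+* ℝ) (t : V →ₗ[C] C) {X : V}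
    (hX : ∀ α, ε (D.met X (D.ξ α)) = 0) : ε (t X) = ε (t (-D.f (D.f X))) := by
  conv_lhs => rw [D.decomp X]
  simp [hX]

/-- The curvature is linear over functions in each slot, so the slots can be moved to the first or
last place and made horizontal one by one. This allows fields that lie in 𝓛 at one point only. -/
theorem eval_curv_horizontal (ε : C →+* ℝ) {X Y : V}
    (hX : ∀ α, ε (D.met X (D.ξ α)) = 0) (hY : ∀ α, ε (D.met Y (D.ξ α)) = 0) :
    ε (D.curv X Y Y X) =
      ε (D.curv (-D.f (D.f X)) (-D.f (D.f Y)) (-D.f (D.f Y)) (-D.f (D.f X))) := by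
  have h1 (Y Z U : V) {X : V} (hX : ∀ α, ε (D.met X (D.ξ α)) = 0) :
      ε (D.curv X Y Z U) = ε (D.curv (-D.f (D.f X)) Y Z U) :=
    eval_horizontal ε
      { toFun := fun X ↦ D.curv X Y Z U
        map_add' := fun X X' ↦ D.curv_add_left X X' Y Z U
        map_smul' := fun a X ↦ D.curv_smul_left a X Y Z U } hX
  have h4 (X Y Z : V) {U : V} (hU : ∀ α, ε (D.met U (D.ξ α)) = 0) :
      ε (D.curv X Y Z U) = ε (D.curv X Y Z (-D.f (D.f U))) := eval_horizontal ε (D.met _) hU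
  rw [h1 _ _ _ hX, h4 _ _ _ hX, D.curv_skew, D.curv_skew', map_neg, map_neg, neg_neg,
    h1 _ _ _ hY, h4 _ _ _ hY, ← neg_neg (ε _), ← map_neg, ← map_neg, ← D.curv_skew', map_neg,
    ← map_neg ε, ← D.curv_skew]

/-! ### Covariant derivatives of ξ_α and f -/

variable (D)

/-- The covariant derivative of the skew form Φ is skew. -/
theorem nablaF_skew (X Y Z : V) : D.met (D.nablaF X Y) Z = -D.met (D.nablaF X Z) Y := by
  have h1 := D.act_met X (D.f Y) Z
  have h2 := D.act_met X Y (D.f Z)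
  have h3 := D.met_symm Y (D.nablaF X Z)
  have h4 := D.met_f_left Y (D.nabla X Z)
  have h5 := D.met_f_left (D.nabla X Y) Z
  rw [D.met_f_left, map_neg] at h1
  rw [D.nabla_f, map_add] at h1 h2
  simp only [LinearMap.add_apply] at h1 h2
  linear_combination -h1 - h2 - h3 - h4 - h5

/-- Normality with every bracket expanded by the torsion-free connection. -/
theorem nablaF_normal (X Y : V) : D.nablaF (D.f X) Y - D.nablaF (D.f Y) X + D.f (D.nablaF Y X)
    - D.f (D.nablaF X Y) + ∑ α, (2 * D.met X (D.f Y)) • D.ξ α = 0 := by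
  rw [← D.normal X Y]
  simp only [D.br_eq, D.nabla_f, map_add, map_sub]
  abel

variable [Algebra ℝ C]

theorem eq_of_two_mul_eq {C : Type*} [CommRing C] [Algebra ℝ C] {a b : C} (h : 2 * a = 2 * b) :
    a = b := by
  refine sub_eq_zero.1 (two_cancel ?_)
  linear_combination h

/-- The fundamental form is closed. -/
theorem fundamental_closed (α : Fin s) (X Y Z : V) :
    D.act X (D.met Y (D.f Z)) + D.act Y (D.met Z (D.f X)) + D.act Z (D.met X (D.f Y)) =
      D.met (D.br X Y) (D.f Z) + D.met (D.br Y Z) (D.f X) + D.met (D.br Z X) (D.f Y) := by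
  apply eq_of_two_mul_eq
  -- This is d(dη^α) = 0: sum the derivatives of the contact identity cyclically; the remaining
  -- bracket terms cancel by Jacobi.
  have a1 := congrArg (D.act X) (D.contact α Y Z)
  have a2 := congrArg (D.act Y) (D.contact α Z X)
  have a3 := congrArg (D.act Z) (D.contact α X Y)
  have b1 := D.contact α (D.br X Y) Z
  have b2 := D.contact α (D.br Y Z) X
  have b3 := D.contact α (D.br Z X) Y
  have j := congrArg (fun U ↦ D.met U (D.ξ α)) (D.jacobi X Y Z)
  rw [D.br_skew X (D.br Y Z), D.br_skew Y (D.br X Z), D.br_skew X Z] at j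
  have e : D.br (-D.br Z X) Y = -D.br (D.br Z X) Y := by
    rw [← neg_one_smul C, D.br_smul_left, map_neg, D.act_one]; simp
  rw [e] at j
  simp only [D.act_two_mul, map_sub, map_add, map_neg, LinearMap.add_apply, LinearMap.neg_apply]
    at a1 a2 a3 j
  rw [D.act_br] at b1 b2 b3
  linear_combination a1 + a2 + a3 - b1 - b2 - b3 - j

/-- L_{ξ_α} Φ = 0, as in Cartan's formula: Φ is closed and ξ_α lies in its kernel. -/
theorem ξ_act_fundamental (α : Fin s) (X Y : V) :
    D.act (D.ξ α) (D.met X (D.f Y)) =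
      D.met (D.br (D.ξ α) X) (D.f Y) + D.met X (D.f (D.br (D.ξ α) Y)) := by
  have h := D.fundamental_closed α (D.ξ α) X Y
  rw [D.f_ξ, D.met_ξ_f, map_zero, map_zero, map_zero, map_zero, D.br_skew Y, map_neg,
    LinearMap.neg_apply] at h
  have h1 := D.met_f_left (D.br (D.ξ α) Y) X
  rw [D.met_symm] at h1
  linear_combination h - h1

/-- The structure vector fields are Killing fields. -/
theorem ξ_killing (α : Fin s) (X Y : V) :
    D.act (D.ξ α) (D.met X Y) = D.met (D.br (D.ξ α) X) Y + D.met X (D.br (D.ξ α) Y) := by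
  have hf (Y : V) : D.act (D.ξ α) (D.met X (D.f Y)) =
      D.met (D.br (D.ξ α) X) (D.f Y) + D.met X (D.br (D.ξ α) (D.f Y)) := by
    rw [D.ξ_act_fundamental, D.ξ_br_f]
  have hξ (β : Fin s) : D.act (D.ξ α) (D.met X (D.ξ β)) =
      D.met (D.br (D.ξ α) X) (D.ξ β) + D.met X (D.br (D.ξ α) (D.ξ β)) := by
    rw [D.met_ξ_br, D.ξ_br_ξ, map_zero, add_zero]
  have hadd {Y Y' : V} (h : D.act (D.ξ α) (D.met X Y) =
      D.met (D.br (D.ξ α) X) Y + D.met X (D.br (D.ξ α) Y)) (h' : D.act (D.ξ α) (D.met X Y') =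
      D.met (D.br (D.ξ α) X) Y' + D.met X (D.br (D.ξ α) Y')) :
      D.act (D.ξ α) (D.met X (Y + Y')) =
      D.met (D.br (D.ξ α) X) (Y + Y') + D.met X (D.br (D.ξ α) (Y + Y')) := by
    rw [D.br_add_right]; simp only [map_add]; linear_combination h + h'
  have hsmul {Y : V} (a : C) (h : D.act (D.ξ α) (D.met X Y) =
      D.met (D.br (D.ξ α) X) Y + D.met X (D.br (D.ξ α) Y)) :
      D.act (D.ξ α) (D.met X (a • Y)) =
      D.met (D.br (D.ξ α) X) (a • Y) + D.met X (D.br (D.ξ α) (a • Y)) := by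
    rw [D.br_smul_right]; simp only [map_add, map_smul, smul_eq_mul, D.act_mul]
    linear_combination a * h
  -- Y is a sum of an image of f, where g reduces to Φ, and of multiples of the ξ_β.
  rw [D.decomp Y]
  refine hadd ?_ ?_
  · rw [← map_neg]; exact hf _
  · refine Finset.sum_induction _ (fun Y ↦ D.act (D.ξ α) (D.met X Y) =
      D.met (D.br (D.ξ α) X) Y + D.met X (D.br (D.ξ α) Y)) (fun _ _ ↦ hadd) ?_ fun β _ ↦
        hsmul _ (hξ β)
    simp [D.br_zero_right]

/-- The Killing equation makes ∇ξ_α skew, and the contact identity says that its skew part is given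
by Φ. -/
theorem nabla_ξ (α : Fin s) (X : V) : D.nabla X (D.ξ α) = -D.f X := by
  refine D.met_ext fun Y ↦ eq_of_two_mul_eq ?_
  have h := D.ξ_killing α X Y
  rw [D.act_met, D.br_eq, D.br_eq] at h
  have h' := D.contact α X Y
  rw [D.act_met, D.act_met, D.br_eq] at h'
  have h1 := D.met_f_left X Y
  simp only [map_sub, LinearMap.sub_apply, map_neg, LinearMap.neg_apply] at h h' ⊢
  have h3 := D.met_symm Y (D.nabla X (D.ξ α))
  linear_combination h - h' + 2 * h1 - h3

theorem nablaF_ξ (X : V) (α : Fin s) : D.nablaF X (D.ξ α) = D.f (D.f X) := by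
  simp [nablaF, D.f_ξ, D.nabla_ξ]

theorem ξ_nablaF (α : Fin s) (X : V) : D.nablaF (D.ξ α) X = 0 := by
  have h := D.ξ_br_f α X
  rw [D.br_eq, D.br_eq, D.nabla_ξ, D.nabla_ξ, D.nabla_f, map_sub, map_neg] at h
  linear_combination (norm := module) h

/-- The closedness of Φ, written with the torsion-free connection. -/
theorem nablaF_cyclic (α : Fin s) (X Y Z : V) : D.met (D.nablaF X Y) Z + D.met (D.nablaF Y Z) X
    + D.met (D.nablaF Z X) Y = 0 := by
  have h := D.fundamental_closed α X Y Z
  simp only [D.act_met, D.nabla_f, D.br_eq, map_add, map_sub, LinearMap.sub_apply] at h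
  have h1 := D.nablaF_skew X Y Z
  have h2 := D.nablaF_skew Y Z X
  have h3 := D.nablaF_skew Z X Y
  have k1 := D.met_symm Y (D.nablaF X Z)
  have k2 := D.met_symm Z (D.nablaF Y X)
  have k3 := D.met_symm X (D.nablaF Z Y)
  have e (X Y : V) : D.met X (D.f Y) = -D.met Y (D.f X) := by rw [D.met_symm, D.met_f_left]
  linear_combination h1 + h2 + h3 - h + k1 + k2 + k3 + e Y (D.nabla X Z) + e Z (D.nabla Y X)
    + e X (D.nabla Z Y)

variable {D}

/-- The tensor `∇f` vanishes on `𝓛`, up to its vertical part. -/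
theorem met_nablaF_eq_zero (α : Fin s) {X Y Z : V} (hX : X ∈ D.distL) (hY : Y ∈ D.distL)
    (hZ : Z ∈ D.distL) : D.met (D.nablaF X Y) Z = 0 := by
  -- Differentiate f² = -1 on 𝓛: up to vertical terms, ∇_X f anticommutes with f. The rest is the
  -- proof that a Hermitian structure with integrable J and closed Kähler form has ∇J = 0.
  have hJ (X : V) {Y Z : V} (hY : Y ∈ D.distL) (hZ : Z ∈ D.distL) :
      D.met (D.nablaF X (D.f Y)) Z = D.met (D.nablaF X Y) (D.f Z) := by
    have h1 := D.nabla_f X (D.f Y)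
    have h2 := congrArg D.f (D.nabla_f X Y)
    have h3 := congrArg (fun U ↦ D.met U Z) (h1.trans (congrArg _ h2))
    have h4 := D.met_f_left (D.nablaF X Y) Z
    have h5 := D.met_f_left (D.f (D.nabla X Y)) Z
    rw [met_f_of_mem hZ] at h5
    rw [f_f_of_mem hY] at h3
    simp only [map_neg, map_add, LinearMap.add_apply, LinearMap.neg_apply] at h3
    linear_combination -h3 - h4 - h5
  have hN (X Y : V) {Z : V} (hZ : Z ∈ D.distL) :
      D.met (D.nablaF (D.f X) Y) Z - D.met (D.nablaF (D.f Y) X) Z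
        - D.met (D.nablaF Y X) (D.f Z) + D.met (D.nablaF X Y) (D.f Z) = 0 := by
    have h := congrArg (fun U ↦ D.met U Z) (D.nablaF_normal X Y)
    have hξ (β : Fin s) : D.met (D.ξ β) Z = 0 := by rw [D.met_symm, hZ β]
    simp only [map_add, map_sub, map_sum, map_smul, LinearMap.add_apply, LinearMap.sub_apply,
      LinearMap.sum_apply, LinearMap.smul_apply, hξ, smul_zero, Finset.sum_const_zero, map_zero,
      LinearMap.zero_apply, D.met_f_left] at h
    linear_combination h
  have hG {X Y Z : V} (hX : X ∈ D.distL) (hY : Y ∈ D.distL) (hZ : Z ∈ D.distL) :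
      D.met (D.nablaF (D.f X) Y) Z = -D.met (D.nablaF X Y) (D.f Z) := by
    have s1 (X Y Z : V) (hY : Y ∈ D.distL) (hZ : Z ∈ D.distL) :
        D.met (D.nablaF X Y) (D.f Z) = -D.met (D.nablaF X Z) (D.f Y) := by
      rw [← hJ X hY hZ, D.nablaF_skew]
    have s2 (X Y Z : V) := D.nablaF_skew (D.f X) Y Z
    -- An alternating sum of the three cyclic versions of `hN`, as in the Koszul formula, isolates
    -- one term.
    apply eq_of_two_mul_eq
    linear_combination hN X Y hZ - hN Y Z hX + hN Z X hY + s1 X Y Z hY hZ + s1 Y Z X hZ hX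
      - s1 Z X Y hX hY + s2 X Y Z + s2 Y Z X - s2 Z X Y
  have hF {X Y Z : V} (hX : X ∈ D.distL) (hY : Y ∈ D.distL) (hZ : Z ∈ D.distL) :
      D.met (D.nablaF X Y) (D.f Z) = 0 := by
    -- In the closedness identities for (Z, X, fY) and (fZ, X, Y), `hJ` and `hG` cancel everything
    -- but two equal terms.
    refine two_cancel ?_
    have c1 := D.nablaF_cyclic α Z X (D.f Y)
    have c2 := D.nablaF_cyclic α (D.f Z) X Y
    linear_combination c1 + c2 - hJ X hY hZ - hG hY hZ hX - hG hZ hX hY - hJ Y hZ hX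
  have h := hF hX hY (f_mem_distL Z)
  rw [f_f_of_mem hZ, map_neg] at h
  exact neg_eq_zero.1 h

theorem nabla_xiSum (X : V) : D.nabla X D.xiSum = -((s : C) • D.f X) := by
  simp [xiSum, D.nabla_ξ, Nat.cast_smul_eq_nsmul]

/-- The covariant derivative of `f` in an `S`-manifold. -/
theorem nablaF_eq (α : Fin s) (X Y : V) :
    D.nablaF X Y = D.met (D.f X) (D.f Y) • D.xiSum + D.met Y D.xiSum • D.f (D.f X) := by
  have hL {X Y : V} (hX : X ∈ D.distL) (hY : Y ∈ D.distL) :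
      D.nablaF X Y = D.met (D.f X) (D.f Y) • D.xiSum := by
    refine met_ext_distL (D := D) (fun Z hZ ↦ ?_) fun β ↦ ?_
    · rw [met_nablaF_eq_zero α hX hY hZ, map_smul, LinearMap.smul_apply, D.met_symm D.xiSum,
        met_xiSum_of_mem hZ, smul_zero]
    -- The vertical part is found by moving ∇_X f onto ξ_β.
    · rw [D.nablaF_skew, D.nablaF_ξ, D.met_f_left, map_smul, LinearMap.smul_apply, D.met_symm,
        D.met_symm D.xiSum, met_ξ_xiSum, smul_eq_mul, mul_one, D.met_symm, neg_neg]
  have hL' (X : V) {Y : V} (hY : Y ∈ D.distL) :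
      D.nablaF X Y = D.met (D.f X) (D.f Y) • D.xiSum := by
    -- The vertical part of X contributes nothing, by `ξ_nablaF`.
    conv_lhs => rw [D.decomp X, ← map_neg]
    rw [map_add, LinearMap.add_apply, hL (f_mem_distL _) hY, met_f_of_mem hY, met_f_of_mem hY]
    simp only [map_sum, map_smul, LinearMap.sum_apply, LinearMap.smul_apply, D.ξ_nablaF, smul_zero,
      Finset.sum_const_zero, add_zero]
    congr 1
    conv_rhs => rw [D.decomp X, ← map_neg]
    simp only [map_add, map_sum, map_smul, LinearMap.add_apply, LinearMap.sum_apply,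
      LinearMap.smul_apply, D.met_symm _ Y, hY _, smul_zero, Finset.sum_const_zero, add_zero]
  conv_lhs => rw [D.decomp Y, ← map_neg]
  rw [map_add, hL' X (f_mem_distL _), map_neg, map_neg, f_f_of_mem (f_mem_distL Y), neg_neg]
  simp only [map_sum, map_smul, D.nablaF_ξ, xiSum, Finset.sum_smul]

/-! ### Curvature on 𝓛 -/

/-- The Ricci identity for `f` on `𝓛`. -/
theorem curv_f (α : Fin s) {X Y Z W : V} (hX : X ∈ D.distL) (hY : Y ∈ D.distL) (hZ : Z ∈ D.distL)
    (hW : W ∈ D.distL) : D.curv X Y (D.f Z) W + D.curv X Y Z (D.f W) =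
      s * (D.met X Z * D.met (D.f Y) W - D.met Y Z * D.met (D.f X) W
        + D.met Z (D.f X) * D.met Y W - D.met Z (D.f Y) * D.met X W) := by
  have hΞ {W : V} (hW : W ∈ D.distL) : D.met D.xiSum W = 0 := by
    rw [D.met_symm, met_xiSum_of_mem hW]
  -- The factor s arises here and in `k2`, from ∇_X ξ̄ = -s fX.
  have k1 (X Y : V) (hY : Y ∈ D.distL) :
      D.met (D.nabla X (D.nablaF Y Z)) W = -(s * D.met Y Z * D.met (D.f X) W) := by
    rw [nablaF_eq α Y Z, met_xiSum_of_mem hZ, zero_smul, add_zero, D.nabla_smul, nabla_xiSum,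
      met_f_of_mem hZ]
    simp only [map_add, map_smul, map_neg, LinearMap.add_apply, LinearMap.smul_apply,
      LinearMap.neg_apply, hΞ hW, smul_eq_mul]
    ring
  have k2 (X Y : V) (hX : X ∈ D.distL) :
      D.met (D.nablaF X (D.nabla Y Z)) W = -(s * D.met Z (D.f Y) * D.met X W) := by
    -- Differentiating g(Z, ξ̄) = 0 gives the vertical part of ∇_Y Z.
    have h := D.act_met Y Z D.xiSum
    rw [met_xiSum_of_mem hZ, nabla_xiSum, map_zero] at h
    rw [nablaF_eq α, f_f_of_mem hX]
    simp only [map_add, map_smul, map_neg, LinearMap.add_apply, LinearMap.smul_apply,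
      LinearMap.neg_apply, hΞ hW, smul_eq_mul] at h ⊢
    linear_combination D.met X W * h
  have k3 (U : V) : D.met (D.nablaF U Z) W = 0 := by
    rw [nablaF_eq α, met_xiSum_of_mem hZ, zero_smul, add_zero, map_smul, LinearMap.smul_apply,
      hΞ hW, smul_zero]
  simp only [RiemannianAlgebra.curv, D.nabla_f, map_add, map_sub, LinearMap.add_apply,
    LinearMap.sub_apply, D.met_f_left, k1 X Y hY, k1 Y X hX, k2 X Y hX, k2 Y X hY, k3]
  ring

/-- The difference of the curvature tensor and of the tensor of constant curvature `s`. -/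
def curvDiff (D : SAlgebra s C V) (X Y Z U : V) : C :=
  D.curv X Y Z U - s * (D.met Y Z * D.met X U - D.met X Z * D.met Y U)

/-- With fU in the last slot of `curv_f`, the right-hand side is the f-invariance defect of s times
the tensor of constant curvature 1. -/
theorem curvDiff_f (α : Fin s) {X Y Z U : V} (hX : X ∈ D.distL) (hY : Y ∈ D.distL)
    (hZ : Z ∈ D.distL) (hU : U ∈ D.distL) :
    D.curvDiff X Y (D.f Z) (D.f U) = D.curvDiff X Y Z U := by
  have h := curv_f α hX hY hZ (f_mem_distL U)
  have e : D.curv X Y Z (-U) = -D.curv X Y Z U := map_neg _ _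
  rw [f_f_of_mem hU, e] at h
  have e1 := D.met_f_left X U
  have e2 := D.met_f_left Y U
  have e3 := D.met_symm Z (D.f X)
  have e4 := D.met_symm Z (D.f Y)
  have e5 := D.met_f_left X Z
  have e6 := D.met_f_left Y Z
  rw [met_f_of_mem hU, met_f_of_mem hU, e3, e4, e5, e6] at h
  simp only [curvDiff]
  linear_combination h

theorem isKaehlerCurvature (α : Fin s) (ε : C →+* ℝ) :
    IsKaehlerCurvature ((D.f.restrict fun X _ ↦ f_mem_distL X : D.distL →ₗ[C] D.distL) :
      D.distL →+ D.distL) fun X Y Z U ↦ ε (D.curvDiff X Y Z U) where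
  J_sq X := Subtype.ext (f_f_of_mem X.2)
  add_left X X' Y Z U := by
    rw [← map_add]
    congr 1
    simp only [curvDiff, Submodule.coe_add, D.curv_add_left, map_add, LinearMap.add_apply]
    ring
  skew X Y Z U := by
    rw [← map_neg]
    congr 1
    simp only [curvDiff, D.curv_skew X Y]
    ring
  skew' X Y Z U := by
    rw [← map_neg]
    congr 1
    simp only [curvDiff, D.curv_skew' X Y Z]
    ring
  bianchi X Y Z U := by
    rw [← map_add, ← map_add, ← map_zero ε]
    congr 1
    have h := D.curv_bianchi X Y Z U
    simp only [curvDiff]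
    linear_combination h +
      s * (D.met_symm Y X * D.met Z U + D.met_symm Z Y * D.met X U + D.met_symm X Z * D.met Y U)
  J_inv X Y Z U := congrArg ε (curvDiff_f α X.2 Y.2 Z.2 U.2)

/-- The sectional curvatures of an `S`-space-form. -/
theorem curv_of_const (α : Fin s) (ε : C →+* ℝ)
    (hε : ∀ X, ε (D.met X X) = 0 → ∀ Y, ε (D.met X Y) = 0) {c : ℝ}
    (hc : ∀ X ∈ D.distL, ε (D.met X X) ≠ 0 →
      ε (D.curv X (D.f X) (D.f X) X) = c * ε (D.met X X) ^ 2)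
    {X Y : V} (hX : X ∈ D.distL) (hY : Y ∈ D.distL) (hX0 : ε (D.met X X) ≠ 0) :
    4 * ε (D.curv X Y Y X) =
      (c + 3 * s) * (ε (D.met X X) * ε (D.met Y Y) - ε (D.met X Y) ^ 2)
        + 3 * (c - s) * ε (D.met X (D.f Y)) ^ 2 := by
  have hdiff (X Y : V) : ε (D.curvDiff X Y Y X) =
      ε (D.curv X Y Y X) - s * (ε (D.met X X) * ε (D.met Y Y) - ε (D.met X Y) ^ 2) := by
    simp only [curvDiff, map_sub, map_mul, map_natCast, D.met_symm Y X]
    ring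
  have h := (isKaehlerCurvature α ε).sectional_of_hol (q := fun X Y ↦ ε (D.met X Y)) (k := c - s)
    (fun X X' Y ↦ by simp) (fun X Y ↦ by rw [D.met_symm])
    (fun X Y ↦ congrArg ε (met_f_of_mem Y.2 X.1)) (fun X h Y ↦ hε X h Y) (fun X h ↦ by
      have e : ε (D.met X (D.f X)) = 0 := by
        have h1 := congrArg ε (D.met_f_left X.1 X.1)
        rw [D.met_symm, map_neg] at h1
        linarith
      have e' : ε (D.met (D.f X) (D.f X)) = ε (D.met X X) := congrArg ε (met_f_of_mem X.2 _)
      refine (hdiff X (D.f X)).trans ?_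
      rw [hc X X.2 h, e, e']
      ring) ⟨X, hX⟩ ⟨Y, hY⟩ hX0
  have h1 : (4 : ℝ) * ε (D.curvDiff X Y Y X) = (c - s) * (ε (D.met X X) * ε (D.met Y Y)
    - ε (D.met X Y) ^ 2 + 3 * ε (D.met X (D.f Y)) ^ 2) := h
  rw [hdiff] at h1
  linarith

end SAlgebra
end Algebra
end SGeometry

namespace SGeometry
open Bundle Manifold VectorField FiberBundle

/-! ### Smooth functions and smooth vector fields on a manifold -/

noncomputable section Fields

variable {E : Type*} [NormedAddCommGroup E] [NormedSpace ℝ E]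
  {H : Type*} [TopologicalSpace H] {I : ModelWithCorners ℝ E H}
  {M : Type*} [TopologicalSpace M] [ChartedSpace H M]

theorem contMDiffAt_det {ι : Type*} [Fintype ι] [DecidableEq ι] {A : M → Matrix ι ι ℝ} {x : M}
    (hA : ∀ i j, CMDiffAt ∞ (fun y ↦ A y i j) x) : CMDiffAt ∞ (fun y ↦ (A y).det) x := by
  simp only [Matrix.det_apply']
  exact contMDiffAt_finsetSum fun σ _ ↦ contMDiffAt_const.mul
    (contMDiffAt_finsetProd fun i _ ↦ hA _ _)

variable (I M) in
/-- The ring of smooth functions. -/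
abbrev SmoothFun := C^∞⟮I, M; 𝓘(ℝ), ℝ⟯

theorem SmoothFun.two_mul_apply (a : SmoothFun I M) (x : M) : (2 * a) x = 2 * a x := by
  rw [two_mul, two_mul]; rfl

variable [IsManifold I ∞ M]

theorem IsSmoothField.contMDiff_mvfderiv {X : Π x : M, TangentSpace I x} (hX : IsSmoothField X)
    {h : M → ℝ} (hh : ContMDiff I 𝓘(ℝ) ∞ h) :
    ContMDiff I 𝓘(ℝ) ∞ fun x ↦ mvfderiv I h x (X x) :=
  contMDiff_snd_tangentBundle_modelSpace ℝ 𝓘(ℝ) |>.comp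
    ((hh.contMDiff_tangentMap (m := ∞) (by simp)).comp hX)

theorem IsSmoothField.lieBracket [CompleteSpace E] {X Y : Π x : M, TangentSpace I x}
    (hX : IsSmoothField X) (hY : IsSmoothField Y) : IsSmoothField (mlieBracket I X Y) := by
  have : IsManifold I (((⊤ : ℕ∞) : WithTop ℕ∞) + 1) M := by simpa using ‹IsManifold I ∞ M›
  have : IsManifold I (minSmoothness ℝ 2) M := by
    rw [minSmoothness_of_isRCLikeNormedField]
    exact IsManifold.of_le (n := ∞) ENat.LEInfty.out
  exact ContDiff.mlieBracket_vectorField (n := ⊤) (m := ⊤) hX hY (by simp)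

theorem IsSmoothField.jacobi [CompleteSpace E] {X Y Z : Π x : M, TangentSpace I x}
    (hX : IsSmoothField X) (hY : IsSmoothField Y) (hZ : IsSmoothField Z) :
    mlieBracket I X (mlieBracket I Y Z) =
      mlieBracket I (mlieBracket I X Y) Z + mlieBracket I Y (mlieBracket I X Z) := by
  have : IsManifold I (minSmoothness ℝ 3) M := by
    rw [minSmoothness_of_isRCLikeNormedField]
    exact IsManifold.of_le (n := ∞) ENat.LEInfty.out
  have h2 : minSmoothness ℝ 2 ≤ ∞ := by
    rw [minSmoothness_of_isRCLikeNormedField]; exact ENat.LEInfty.out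
  exact leibniz_identity_mlieBracket (ContMDiff.of_le hX h2) (ContMDiff.of_le hY h2)
    (ContMDiff.of_le hZ h2)

theorem IsSmoothField.mdifferentiableAt {X : Π x : M, TangentSpace I x} (hX : IsSmoothField X)
    (x : M) : MDiffAt (T% X) x :=
  (hX x).mdifferentiableAt (by simp)

/-- Every tangent vector is the value of a smooth vector field. -/
theorem exists_isSmoothField [FiniteDimensional ℝ E] [T2Space M] (x : M) (v : TangentSpace I x) :
    ∃ X : Π x : M, TangentSpace I x, IsSmoothField X ∧ X x = v := by
  obtain ⟨u, hu, hs⟩ := exists_contMDiffOn_extend (k := ∞) I E v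
  obtain ⟨w, hwu, hw, hxw⟩ := mem_nhds_iff.1 hu
  obtain ⟨ψ, -, hψ⟩ := (SmoothBumpFunction.nhds_basis_tsupport (I := I) x).mem_iff.1
    (hw.mem_nhds hxw)
  refine ⟨(ψ : M → ℝ) • extend E v, ?_, ?_⟩
  · exact ContMDiffOn.smul_section_of_tsupport ψ.contMDiff.contMDiffOn hw hψ (hs.mono hwu)
  · simp

variable (g : ContMDiffRiemannianMetric I ∞ E (fun x : M ↦ TangentSpace I x))

theorem contMDiffAt_metric {x : M} {X Y : Π x : M, TangentSpace I x}
    (hX : CMDiffAt ∞ (T% X) x) (hY : CMDiffAt ∞ (T% Y) x) :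
    CMDiffAt ∞ (fun y ↦ g.inner y (X y) (Y y)) x := by
  have : ContMDiffAt I (I.prod 𝓘(ℝ)) ∞
      (fun m ↦ TotalSpace.mk' ℝ (E := Bundle.Trivial M ℝ) m (g.inner m (X m) (Y m))) x := by
    apply ContMDiffAt.clm_bundle_apply₂ (F₁ := E) (F₂ := E)
    · exact g.contMDiff x
    · exact hX
    · exact hY
  simp only [contMDiffAt_totalSpace] at this
  exact this.2

/-- A vector field is smooth if its inner products with smooth vector fields are smooth. -/
theorem contMDiffAt_of_metric [FiniteDimensional ℝ E] [T2Space M] {V : Π x : M, TangentSpace I x}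
    {x : M} (hV : ∀ W : Π x : M, TangentSpace I x, IsSmoothField W →
      CMDiffAt ∞ (fun y ↦ g.inner y (W y) (V y)) x) : CMDiffAt ∞ (T% V) x := by
  classical
  set e := trivializationAt E (TangentSpace I : M → Type _) x
  have hx : x ∈ e.baseSet := FiberBundle.mem_baseSet_trivializationAt' x
  set b := Module.finBasis ℝ E
  rw [contMDiffAt_iff_localFrameCoeff (I := I) b hx]
  -- Global smooth fields that agree with the local frame at x only, so A is the Gram matrix at x
  -- and stays invertible nearby.
  choose W hW hWx using fun i ↦ exists_isSmoothField x (e.localFrame b i x)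
  let A (y : M) : Matrix _ _ ℝ := Matrix.of fun i j ↦ g.inner y (W i y) (e.localFrame b j y)
  have hA (i j) : CMDiffAt ∞ (fun y ↦ A y i j) x :=
    contMDiffAt_metric g (hW i x) (contMDiffAt_localFrame_of_mem ∞ e b j hx)
  have hdet := contMDiffAt_det hA
  have h0 : (A x).det ≠ 0 := by
    intro h
    obtain ⟨v, hv, hv'⟩ := Matrix.exists_mulVec_eq_zero_iff.2 h
    set w : TangentSpace I x := ∑ j, v j • e.localFrame b j x
    have hw (i) : g.inner x w (e.localFrame b i x) = 0 := by
      have := congrFun hv' i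
      rw [g.symm x, map_sum]
      simpa [A, Matrix.mulVec, dotProduct, hWx, mul_comm] using this
    have hw0 : w = 0 := by
      by_contra h
      refine (g.pos x w h).ne' ?_
      conv_lhs => enter [2]; rw [show w = ∑ j, v j • e.localFrame b j x from rfl]
      rw [map_sum]
      simp only [map_smul, hw, smul_zero, Finset.sum_const_zero]
    simp only [w, e.localFrame_apply_of_mem_baseSet b hx] at hw0
    exact hv (funext (Fintype.linearIndependent_iff.1 (e.basisAt b hx).linearIndependent v hw0))
  intro i
  -- Cramer's rule expresses the frame coefficients of V as quotients of smooth determinants.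
  have hd : CMDiffAt ∞ (fun y ↦ ((A y).updateCol i fun j ↦ g.inner y (W j y) (V y)).det) x := by
    refine contMDiffAt_det fun j k ↦ ?_
    by_cases hk : k = i
    · subst hk
      simpa using hV _ (hW j)
    · simpa [hk] using hA j k
  refine (hd.mul (hdet.inv₀ h0)).congr_of_eventuallyEq ?_
  filter_upwards [e.open_baseSet.mem_nhds hx, hdet.continuousAt.eventually_ne h0] with y hy hy0
  set c := fun j ↦ e.localFrameCoeff I b j y (V y)
  have hc : (A y).mulVec c = fun j ↦ g.inner y (W j y) (V y) := by
    ext j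
    have hVy : V y = ∑ i, c i • e.localFrame b i y := e.eq_sum_localFrameCoeff_smul hy
    conv_rhs => rw [hVy, map_sum]
    simp [A, Matrix.mulVec, dotProduct, mul_comm]
  have h1 : (A y).cramer ((A y).mulVec c) i = (A y).det * c i := by
    rw [Matrix.cramer_eq_adjugate_mulVec, Matrix.mulVec_mulVec, Matrix.adjugate_mul,
      Matrix.smul_mulVec, Matrix.one_mulVec]
    rfl
  rw [hc, Matrix.cramer_apply] at h1
  change c i = Matrix.det _ * (A y).det⁻¹
  rw [h1]
  field_simp

variable (I M) in
/-- The module of smooth vector fields. -/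
abbrev SmoothVF := Cₛ^∞⟮I; E, (TangentSpace I : M → Type _)⟯

/-- With functions as scalars, linearity expresses tensoriality. -/
instance : Module (SmoothFun I M) (SmoothVF I M) where
  smul a X := ⟨fun x ↦ a x • X x, a.contMDiff.smul_section X.contMDiff⟩
  one_smul X := by ext x; exact one_smul ℝ _
  mul_smul a b X := by ext x; exact mul_smul (a x) (b x) (X x)
  smul_zero a := by ext x; exact smul_zero (a x)
  smul_add a X Y := by ext x; exact smul_add (a x) (X x) (Y x)
  add_smul a b X := by ext x; exact add_smul (a x) (b x) (X x)
  zero_smul X := by ext x; exact zero_smul ℝ (X x)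

theorem SmoothVF.sum_smul_apply {ι : Type*} (t : Finset ι) (a : ι → SmoothFun I M)
    (X : ι → SmoothVF I M) (x : M) : (∑ i ∈ t, a i • X i) x = ∑ i ∈ t, a i x • X i x :=
  map_sum ((Pi.evalAddMonoidHom (fun x : M ↦ TangentSpace I x) x).comp
    (ContMDiffSection.coeAddHom I E ∞ (TangentSpace I : M → Type _))) _ _

theorem SmoothVF.isSmoothField (X : SmoothVF I M) : IsSmoothField (X : Π x : M, TangentSpace I x) :=
  X.contMDiff

namespace SmoothVF

/-- The derivative of smooth functions along smooth vector fields. -/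
def act : SmoothVF I M →ₗ[SmoothFun I M] SmoothFun I M →+ SmoothFun I M where
  toFun X :=
    { toFun h := ⟨fun x ↦ mvfderiv I h x (X x), X.isSmoothField.contMDiff_mvfderiv h.contMDiff⟩
      map_zero' := by
        ext x
        change mvfderiv I (0 : M → ℝ) x (X x) = 0
        simp
      map_add' a b := by
        ext x
        change mvfderiv I (a + b : M → ℝ) x (X x) = mvfderiv I a x (X x) + mvfderiv I b x (X x)
        rw [mvfderiv_add a.mdifferentiableAt b.mdifferentiableAt]
        rfl }
  map_add' X Y := by
    ext h x
    exact map_add (mvfderiv I h x) (X x) (Y x)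
  map_smul' a X := by
    ext h x
    exact map_smul (mvfderiv I h x) (a x) (X x)

theorem act_mul (X : SmoothVF I M) (a b : SmoothFun I M) :
    act X (a * b) = act X a * b + a * act X b := by
  ext x
  change mvfderiv I (a * b : M → ℝ) x (X x) =
    mvfderiv I a x (X x) * b x + a x * mvfderiv I b x (X x)
  rw [mvfderiv_mul a.mdifferentiableAt b.mdifferentiableAt]
  simp
  ring

end SmoothVF

variable [FiniteDimensional ℝ E]

theorem contMDiff_koszul {X Y Z : Π x : M, TangentSpace I x} (hX : IsSmoothField X)
    (hY : IsSmoothField Y) (hZ : IsSmoothField Z) :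
    ContMDiff I 𝓘(ℝ) ∞ (koszul g X Y Z) := by
  have : CompleteSpace E := FiniteDimensional.complete ℝ E
  have hg {A B : Π x : M, TangentSpace I x} (hA : IsSmoothField A) (hB : IsSmoothField B) :
      ContMDiff I 𝓘(ℝ) ∞ fun y ↦ g.inner y (A y) (B y) :=
    fun x ↦ contMDiffAt_metric g (hA x) (hB x)
  exact contMDiff_const.mul ((((((hX.contMDiff_mvfderiv (hg hY hZ)).add
    (hY.contMDiff_mvfderiv (hg hZ hX))).sub (hZ.contMDiff_mvfderiv (hg hX hY))).add
    (hg (hX.lieBracket hY) hZ)).sub (hg (hX.lieBracket hZ) hY)).sub (hg (hY.lieBracket hZ) hX))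

/-- The covariant derivative of a smooth vector field along a smooth vector field is smooth. -/
theorem IsSmoothField.leviCivita [T2Space M] {X Y : Π x : M, TangentSpace I x}
    (hX : IsSmoothField X) (hY : IsSmoothField Y) :
    IsSmoothField fun x ↦ leviCivita g Y x (X x) := by
  refine fun x ↦ contMDiffAt_of_metric g fun W hW ↦ ?_
  -- By the Koszul formula the inner products with smooth fields are smooth.
  refine ((contMDiff_koszul g hX hY hW) x).congr_of_eventuallyEq (.of_forall fun y ↦ ?_)
  change g.inner y (W y) _ = _
  rw [g.symm]
  exact inner_leviCivitaFun g (hX.mdifferentiableAt y) (hY.mdifferentiableAt y)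
    (hW.mdifferentiableAt y)

namespace SmoothVF

/-- The Lie bracket of smooth vector fields. -/
def bracket (X Y : SmoothVF I M) : SmoothVF I M :=
  have : CompleteSpace E := FiniteDimensional.complete ℝ E
  ⟨mlieBracket I X Y, X.isSmoothField.lieBracket Y.isSmoothField⟩

theorem bracket_jacobi (X Y Z : SmoothVF I M) : bracket X (bracket Y Z) =
    bracket (bracket X Y) Z + bracket Y (bracket X Z) := by
  have : CompleteSpace E := FiniteDimensional.complete ℝ E
  ext x
  exact congrFun (X.isSmoothField.jacobi Y.isSmoothField Z.isSmoothField) x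

theorem bracket_add_right (X Y Z : SmoothVF I M) :
    bracket X (Y + Z) = bracket X Y + bracket X Z := by
  ext x
  exact mlieBracket_add_right Y.mdifferentiableAt Z.mdifferentiableAt

theorem bracket_smul_right (X Y : SmoothVF I M) (a : SmoothFun I M) :
    bracket X (a • Y) = act X a • Y + a • bracket X Y := by
  have : CompleteSpace E := FiniteDimensional.complete ℝ E
  ext x
  exact mlieBracket_smul_right a.mdifferentiableAt Y.mdifferentiableAt

/-- Compare the coefficients of Z in the Jacobi identity for X, Y and aZ. -/
theorem act_bracket [T2Space M] (X Y : SmoothVF I M) (a : SmoothFun I M) :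
    act (bracket X Y) a = act X (act Y a) - act Y (act X a) := by
  have h (Z : SmoothVF I M) :
      act (bracket X Y) a • Z = (act X (act Y a) - act Y (act X a)) • Z := by
    have h1 := bracket_jacobi X Y (a • Z)
    simp only [bracket_smul_right, bracket_add_right] at h1
    rw [bracket_jacobi X Y Z] at h1
    linear_combination (norm := module) -h1
  ext x
  by_cases hx : ∃ v : TangentSpace I x, v ≠ 0
  · obtain ⟨v, hv⟩ := hx
    obtain ⟨Z, hZ, rfl⟩ := exists_isSmoothField x v
    have := congrArg (fun U : SmoothVF I M ↦ U x) (h ⟨Z, hZ⟩)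
    exact smul_left_injective ℝ hv this
  -- If the tangent space is zero, no Z detects the coefficient, but then both sides vanish.
  · push Not at hx
    change mvfderiv I a x (bracket X Y x) =
      mvfderiv I (act Y a) x (X x) - mvfderiv I (act X a) x (Y x)
    rw [hx (bracket X Y x), hx (X x), hx (Y x)]
    simp

end SmoothVF

end Fields
end SGeometry

namespace SGeometry
open Bundle Manifold VectorField FiberBundle

/-! ### The algebra attached to an S-manifold -/

noncomputable section SManifold

variable {E : Type*} [NormedAddCommGroup E] [NormedSpace ℝ E]
  {H : Type*} [TopologicalSpace H] {I : ModelWithCorners ℝ E H}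
  {M : Type*} [TopologicalSpace M] [ChartedSpace H M] [IsManifold I ∞ M]

/-- A common nontrivial zero of fewer linear forms than the dimension. -/
theorem exists_ne_zero_forall_eq_zero {T ι : Type*} [AddCommGroup T] [Module ℝ T]
    [Module.Finite ℝ T] [Fintype ι] (φ : ι → T →ₗ[ℝ] ℝ)
    (h : Fintype.card ι < Module.finrank ℝ T) : ∃ v, v ≠ 0 ∧ ∀ i, φ i v = 0 := by
  have := LinearMap.ker_ne_bot_of_finrank_lt (f := LinearMap.pi φ) (by simpa using h)
  obtain ⟨v, hv, hv0⟩ := Submodule.exists_mem_ne_zero_of_ne_bot this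
  exact ⟨v, hv0, fun i ↦ congrFun hv i⟩

variable (g : ContMDiffRiemannianMetric I ∞ E (fun x : M ↦ TangentSpace I x))

theorem gram_pos {x : M} {v w : TangentSpace I x} (h : LinearIndependent ℝ ![v, w]) :
    0 < g.inner x v v * g.inner x w w - g.inner x v w ^ 2 := by
  have hv : v ≠ 0 := h.ne_zero 0
  have hq := g.pos x v hv
  -- This is g(v,v) times the component of w orthogonal to v; its squared length is g(v,v) times the
  -- Gram determinant.
  have hu : g.inner x v v • w - g.inner x v w • v ≠ 0 := by
    intro h0
    have := LinearIndependent.pair_iff.1 h (-g.inner x v w) (g.inner x v v) (by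
      rw [← h0]; module)
    exact hq.ne' this.2
  have hp := g.pos x _ hu
  simp only [map_sub, map_smul, _root_.sub_apply, _root_.smul_apply,
    smul_eq_mul, g.symm x w v] at hp
  refine pos_of_mul_pos_right (a := g.inner x v v) ?_ hq.le
  linarith

theorem linearIndependent_of_inner_eq_zero {x : M} {v w : TangentSpace I x} (hv : v ≠ 0)
    (hw : w ≠ 0) (h : g.inner x v w = 0) : LinearIndependent ℝ ![v, w] := by
  refine LinearIndependent.pair_iff.2 fun a b hab ↦ ?_
  have h1 := congrArg (g.inner x v) hab
  have h2 := congrArg (g.inner x w) hab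
  simp only [map_add, map_smul, h, g.symm x w v, smul_eq_mul, mul_zero, add_zero, zero_add,
    map_zero] at h1 h2
  exact ⟨(mul_eq_zero.1 h1).resolve_right (g.pos x v hv).ne',
    (mul_eq_zero.1 h2).resolve_right (g.pos x w hw).ne'⟩

namespace MetricFStructure

variable {s : ℕ} (S : MetricFStructure s I M)

/-- Metric compatibility at ξ_α, where f vanishes. This is why `SAlgebra` carries no separate forms
η^α. -/
theorem η_eq (α : Fin s) (x : M) (v : TangentSpace I x) :
    S.η α x v = S.g.inner x v (S.ξ α x) := by
  have h := S.metric_f x v (S.ξ α x)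
  rw [S.f_ξ, map_zero] at h
  simp only [S.η_ξ] at h
  simp at h
  linarith

theorem neg_f_f {x : M} {v : TangentSpace I x} (hv : v ∈ S.distL x) : -S.f x (S.f x v) = v := by
  rw [S.f_sq, Finset.sum_eq_zero fun α _ ↦ by rw [S.η_eq, hv α, zero_smul], add_zero, neg_neg]

theorem inner_f_self {x : M} (v : TangentSpace I x) : S.g.inner x v (S.f x v) = 0 := by
  have h := S.metric_f x v (S.f x v)
  rw [S.f_sq] at h
  simp only [S.η_f, map_add, map_neg, map_sum, map_smul, mul_zero, Finset.sum_const_zero,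
    ← S.η_eq, smul_zero, add_zero, sub_zero] at h
  rw [S.g.symm] at h
  linarith

end MetricFStructure

variable [FiniteDimensional ℝ E] [T2Space M]

/-- The algebra of smooth vector fields on a Riemannian manifold. -/
def riemannianAlgebra (g : ContMDiffRiemannianMetric I ∞ E (fun x : M ↦ TangentSpace I x)) :
    RiemannianAlgebra (SmoothFun I M) (SmoothVF I M) where
  act := SmoothVF.act
  met := LinearMap.mk₂ _
    (fun X Y ↦ ⟨fun x ↦ g.inner x (X x) (Y x), fun x ↦ contMDiffAt_metric g (X.contMDiff x)
      (Y.contMDiff x)⟩)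
    (fun X X' Y ↦ by ext x; exact congrArg (· (Y x)) (map_add (g.inner x) (X x) (X' x)))
    (fun a X Y ↦ by ext x; exact congrArg (· (Y x)) (map_smul (g.inner x) (a x) (X x)))
    (fun X Y Y' ↦ by ext x; exact map_add (g.inner x (X x)) (Y x) (Y' x))
    (fun a X Y ↦ by ext x; exact map_smul (g.inner x (X x)) (a x) (Y x))
  nabla :=
    { toFun X :=
        { toFun Y := ⟨fun x ↦ leviCivita g Y x (X x), X.isSmoothField.leviCivita g Y.isSmoothField⟩
          map_zero' := by
            ext x
            exact congrArg (fun A : Π x : M, TangentSpace I x →L[ℝ] TangentSpace I x ↦ A x (X x))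
              (leviCivita g).zero
          map_add' Y Y' := by
            ext x
            exact congrArg (fun A : TangentSpace I x →L[ℝ] TangentSpace I x ↦ A (X x))
              ((leviCivita g).isCovariantDerivativeOnUniv.add Y.mdifferentiableAt
                Y'.mdifferentiableAt) }
      map_add' X X' := by
        ext Y x
        exact map_add (leviCivita g Y x) (X x) (X' x)
      map_smul' a X := by
        ext Y x
        exact map_smul (leviCivita g Y x) (a x) (X x) }
  br := SmoothVF.bracket
  act_mul := SmoothVF.act_mul
  met_symm X Y := by ext x; exact g.symm x (X x) (Y x)
  met_nondeg X h := by
    ext x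
    by_contra h0
    exact (g.pos x (X x) h0).ne' (congrArg (fun a : SmoothFun I M ↦ a x) (h X))
  nabla_smul X a Y := by
    ext x
    refine (congrArg (fun A : TangentSpace I x →L[ℝ] TangentSpace I x ↦ A (X x))
      ((leviCivita g).isCovariantDerivativeOnUniv.leibniz Y.mdifferentiableAt
        a.mdifferentiableAt)).trans ?_
    exact add_comm _ _
  act_met X Y Z := by
    ext x
    exact leviCivita_metric g X.mdifferentiableAt Y.mdifferentiableAt Z.mdifferentiableAt
  br_eq X Y := by
    ext x
    exact (leviCivita_torsion g X.mdifferentiableAt Y.mdifferentiableAt).symm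
  jacobi := SmoothVF.bracket_jacobi
  act_br X Y a := SmoothVF.act_bracket X Y a

namespace MetricFStructure

variable {s n : ℕ} (S : MetricFStructure s I M)

/-- The algebra of smooth vector fields on an `S`-manifold. -/
def sAlgebra (hS : S.IsSStructure n) : SAlgebra s (SmoothFun I M) (SmoothVF I M) where
  toRiemannianAlgebra := riemannianAlgebra S.g
  f :=
    { toFun X := ⟨fun x ↦ S.f x (X x), S.contMDiff_f.clm_bundle_apply X.contMDiff⟩
      map_add' X Y := by ext x; exact map_add (S.f x) (X x) (Y x)
      map_smul' a X := by ext x; exact map_smul (S.f x) (a x) (X x) }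
  ξ α := ⟨S.ξ α, S.contMDiff_ξ α⟩
  f_sq X := by
    ext x
    refine (S.f_sq x (X x)).trans (congrArg (-X x + ·) ?_)
    rw [SmoothVF.sum_smul_apply]
    exact Finset.sum_congr rfl fun α _ ↦ congrArg (· • S.ξ α x) (S.η_eq α x (X x))
  met_ξ α β := by
    ext x
    refine (S.η_eq β x (S.ξ α x)).symm.trans ((S.η_ξ β α x).trans ?_)
    by_cases h : α = β
    · simp [h]
    · simp [h, Ne.symm h]
  f_ξ α := by ext x; exact S.f_ξ α x
  met_f_ξ α X := by
    ext x
    exact (S.η_eq α x _).symm.trans (S.η_f α x (X x))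
  met_f X Y := by
    ext x
    refine (S.metric_f x (X x) (Y x)).trans (congrArg (S.g.inner x (X x) (Y x) - ·) ?_)
    refine Eq.trans (Finset.sum_congr rfl fun α _ ↦ ?_)
      (map_sum (ContMDiffMap.evalRingHom (I := I) (I' := 𝓘(ℝ)) (n := ∞) (R := ℝ) x) _ _).symm
    rw [S.η_eq, S.η_eq]
    rfl
  normal X Y := by
    ext x
    refine Eq.trans ?_ (hS.normal X Y X.isSmoothField Y.isSmoothField x)
    refine congrArg (nijenhuis S.f X Y x + ·) ?_
    rw [SmoothVF.sum_smul_apply, Finset.smul_sum]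
    refine Finset.sum_congr rfl fun α _ ↦ ?_
    rw [← hS.fundamentalForm_eq α X Y X.isSmoothField Y.isSmoothField, smul_smul]
    exact congrArg (· • S.ξ α x) (SmoothFun.two_mul_apply _ x)
  contact α X Y := by
    ext x
    have h := hS.fundamentalForm_eq α X Y X.isSmoothField Y.isSmoothField x
    simp only [extDerivOneForm, S.η_eq] at h
    refine (SmoothFun.two_mul_apply _ x).trans ((congrArg (2 * ·) h).trans ?_)
    rw [← mul_assoc, mul_one_div_cancel two_ne_zero, one_mul]
    rfl

end MetricFStructure

end SManifold
end SGeometry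

namespace SGeometry
open Bundle Manifold VectorField FiberBundle

/-! ### Sectional curvatures of S-space-forms -/

noncomputable section SSpaceForm

variable {E : Type*} [NormedAddCommGroup E] [NormedSpace ℝ E] [FiniteDimensional ℝ E]
  {H : Type*} [TopologicalSpace H] {I : ModelWithCorners ℝ E H}
  {M : Type*} [TopologicalSpace M] [ChartedSpace H M] [IsManifold I ∞ M] [T2Space M]

namespace MetricFStructure

variable {s n : ℕ} (S : MetricFStructure s I M) (hS : S.IsSStructure n)

/-- The evaluation of smooth functions at a point. -/
abbrev evalAt (x : M) : SmoothFun I M →+* ℝ :=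
  ContMDiffMap.evalRingHom (I := I) (I' := 𝓘(ℝ)) (n := ∞) (R := ℝ) x

theorem sectionalCurvature_eq (X Y : SmoothVF I M) (x : M) :
    sectionalCurvature S.g X Y x = evalAt x ((S.sAlgebra hS).curv X Y Y X) /
      (S.g.inner x (X x) (X x) * S.g.inner x (Y x) (Y x) - S.g.inner x (X x) (Y x) ^ 2) := rfl

theorem mem_distL_iff_eval {X : SmoothVF I M} {x : M} : X x ∈ S.distL x ↔
    ∀ α, evalAt x ((S.sAlgebra hS).met X ((S.sAlgebra hS).ξ α)) = 0 := Iff.rfl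

theorem apply_mem_distL {X : SmoothVF I M} (hX : X ∈ (S.sAlgebra hS).distL) (x : M) :
    X x ∈ S.distL x := fun α ↦ congrArg (evalAt x) (hX α)

/-- Every vector of `𝓛` is the value of a smooth section of `𝓛`. -/
theorem exists_mem_distL {x : M} {v : TangentSpace I x} (hv : v ∈ S.distL x) :
    ∃ X ∈ (S.sAlgebra hS).distL, X x = v := by
  obtain ⟨X, hX, rfl⟩ := exists_isSmoothField x v
  exact ⟨-(S.sAlgebra hS).f ((S.sAlgebra hS).f ⟨X, hX⟩),
    neg_mem (SAlgebra.f_mem_distL _), S.neg_f_f hv⟩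

theorem curv_f_of_const {c : ℝ} (hc : S.HasConstantFSectionalCurvature c) (x : M)
    {X : SmoothVF I M} (hX : X ∈ (S.sAlgebra hS).distL)
    (h0 : X x ≠ 0) :
    evalAt x ((S.sAlgebra hS).curv X ((S.sAlgebra hS).f X) ((S.sAlgebra hS).f X) X) =
      c * S.g.inner x (X x) (X x) ^ 2 := by
  set D := S.sAlgebra hS
  set q := S.g.inner x (X x) (X x) with hq
  have hq0 : 0 < q := S.g.pos x _ h0
  -- A constant rescaling makes the field a unit vector at x, which is all that `hc` asks for; the
  -- curvature is homogeneous of degree four.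
  set r : ℝ := (Real.sqrt q)⁻¹
  have hr : r * r * q = 1 := by
    rw [← mul_inv, Real.mul_self_sqrt hq0.le, inv_mul_cancel₀ hq0.ne']
  set a : SmoothFun I M := algebraMap ℝ _ r
  have ha : evalAt x a = r := rfl
  set Z : SmoothVF I M := a • X with hZ
  have hmem : Z ∈ D.distL := D.distL.smul_mem a hX
  have hval : Z x = r • X x := rfl
  have hunit : S.g.inner x (Z x) (Z x) = 1 := by
    rw [hval]
    simp only [map_smul, _root_.smul_apply, smul_eq_mul]
    rw [← hq, ← mul_assoc, hr]
  have h : sectionalCurvature S.g Z (D.f Z) x = c :=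
    hc Z Z.isSmoothField x (S.apply_mem_distL hS hmem x) hunit
  have hf : S.g.inner x (D.f Z x) (D.f Z x) = 1 := by
    rw [← hunit]
    exact congrArg (evalAt x) (SAlgebra.met_f_of_mem hmem _)
  have hf' : S.g.inner x (Z x) (D.f Z x) = 0 := S.inner_f_self _
  rw [S.sectionalCurvature_eq hS, hunit, hf, hf', hZ, map_smul, D.curv_smul_left, D.curv_smul_two,
    D.curv_smul_three, D.curv_smul_four] at h
  simp only [map_mul, ha] at h
  set K := evalAt x (D.curv X (D.f X) (D.f X) X)
  have hK : r * (r * (r * (r * K))) = c := by simpa using h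
  calc K = (r * r * q) ^ 2 * K := by rw [hr]; ring
    _ = r * (r * (r * (r * K))) * q ^ 2 := by ring
    _ = c * q ^ 2 := by rw [hK]

theorem four_mul_curv {c : ℝ} (hc : S.HasConstantFSectionalCurvature c) (hs : 1 ≤ s)
    (x : M) {X Y : SmoothVF I M} (hX : X ∈ (S.sAlgebra hS).distL)
    (hY : Y ∈ (S.sAlgebra hS).distL) (h0 : X x ≠ 0) :
    4 * evalAt x ((S.sAlgebra hS).curv X Y Y X) =
      (c + 3 * s) * (S.g.inner x (X x) (X x) * S.g.inner x (Y x) (Y x)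
        - S.g.inner x (X x) (Y x) ^ 2)
        + 3 * (c - s) * S.g.inner x (X x) (S.f x (Y x)) ^ 2 := by
  have hne {X : SmoothVF I M} (h : evalAt x ((S.sAlgebra hS).met X X) = 0) : X x = 0 := by
    by_contra h0
    exact (S.g.pos x _ h0).ne' h
  -- Since s ≥ 1 there is an index α, whose η^α shows that Φ is closed.
  refine SAlgebra.curv_of_const ⟨0, hs⟩ (evalAt x) (fun X h Y ↦ ?_)
    (fun X hX h ↦ S.curv_f_of_const hS hc x hX fun h0 ↦ h ?_) hX hY fun h ↦ h0 (hne h)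
  · change S.g.inner x (X x) (Y x) = 0
    rw [hne h, map_zero]; rfl
  · change S.g.inner x (X x) (X x) = 0
    rw [h0, map_zero]

theorem hasConstantLSectionalCurvature_of_eq {s n : ℕ}
    (S : MetricFStructure s I M) (hS : S.IsSStructure n) {c : ℝ}
    (hc : S.HasConstantFSectionalCurvature c) (hs : 1 ≤ s) (h : c = s) :
    S.HasConstantLSectionalCurvature c := by
  intro X Y hX hY x hXx hYx hli
  set D := S.sAlgebra hS
  set X' : SmoothVF I M := ⟨X, hX⟩
  set Y' : SmoothVF I M := ⟨Y, hY⟩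
  have eX : (-D.f (D.f X')) x = X x := S.neg_f_f hXx
  have eY : (-D.f (D.f Y')) x = Y x := S.neg_f_f hYx
  have hP := gram_pos S.g hli
  have h4 := S.four_mul_curv hS hc hs x (neg_mem (SAlgebra.f_mem_distL (D.f X')))
    (neg_mem (SAlgebra.f_mem_distL (D.f Y'))) (by rw [eX]; exact hli.ne_zero 0)
  -- X and Y lie in 𝓛 only at x; -f²X and -f²Y lie in 𝓛 everywhere and have the same values at x.
  rw [← SAlgebra.eval_curv_horizontal (evalAt x) ((S.mem_distL_iff_eval hS).1 hXx)
    ((S.mem_distL_iff_eval hS).1 hYx), eX, eY, h] at h4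
  refine (S.sectionalCurvature_eq hS X' Y' x).trans ((div_eq_iff hP.ne').2 ?_)
  rw [h]
  linarith

theorem eq_of_hasConstantLSectionalCurvature {s n : ℕ}
    (S : MetricFStructure s I M) (hS : S.IsSStructure n) {c : ℝ}
    (hc : S.HasConstantFSectionalCurvature c) (hs : 1 ≤ s) (hdim : s + 2 < Module.finrank ℝ E)
    [Nonempty M] {k : ℝ} (hk : S.HasConstantLSectionalCurvature k) : c = s := by
  set D := S.sAlgebra hS
  obtain ⟨x⟩ := ‹Nonempty M›
  obtain ⟨v, hv0, hv⟩ := exists_ne_zero_forall_eq_zero (T := TangentSpace I x)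
    (fun α ↦ (S.η α x : TangentSpace I x →ₗ[ℝ] ℝ)) (by
      change _ < Module.finrank ℝ E
      simp; omega)
  -- The s forms η^α together with g(v, ·) and g(fv, ·) are s + 2 conditions, fewer than the
  -- dimension.
  obtain ⟨w, hw0, hw⟩ := exists_ne_zero_forall_eq_zero (T := TangentSpace I x)
    (Sum.elim (fun α ↦ (S.η α x : TangentSpace I x →ₗ[ℝ] ℝ))
      ![(S.g.inner x v : TangentSpace I x →ₗ[ℝ] ℝ), S.g.inner x (S.f x v)]) (by
      change _ < Module.finrank ℝ E
      simpa using hdim)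
  have hvw : S.g.inner x v w = 0 := hw (Sum.inr 0)
  have hfvw : S.g.inner x (S.f x v) w = 0 := hw (Sum.inr 1)
  have hvL : v ∈ S.distL x := fun α ↦ (S.η_eq α x v).symm.trans (hv α)
  have hwL : w ∈ S.distL x := fun α ↦ (S.η_eq α x w).symm.trans (hw (Sum.inl α))
  obtain ⟨X, hX, rfl⟩ := S.exists_mem_distL hS hvL
  obtain ⟨Y, hY, rfl⟩ := S.exists_mem_distL hS hwL
  have hff : S.g.inner x (D.f X x) (D.f X x) = S.g.inner x (X x) (X x) :=
    congrArg (evalAt x) (SAlgebra.met_f_of_mem hX _)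
  have hXf : S.g.inner x (X x) (D.f X x) = 0 := S.inner_f_self _
  have hXfY : S.g.inner x (X x) (S.f x (Y x)) = 0 := by
    have := congrArg (evalAt x) (D.met_f_left X Y)
    exact neg_eq_zero.1 (this.symm.trans hfvw)
  have hqX := S.g.pos x _ hv0
  have hqY := S.g.pos x _ hw0
  have hf0 : D.f X x ≠ 0 := by
    intro h0
    rw [h0] at hff
    simp at hff
    exact hqX.ne hff
  -- The two test planes: (X, fX) gives c = k, and (X, Y) with Y orthogonal to X and fX gives 4k = c
  -- + 3s.
  have k1 := hk X (D.f X) X.isSmoothField (D.f X).isSmoothField x hvL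
    (S.apply_mem_distL hS (SAlgebra.f_mem_distL X) x)
    (linearIndependent_of_inner_eq_zero S.g hv0 hf0 hXf)
  have k2 := hk X Y X.isSmoothField Y.isSmoothField x hvL hwL
    (linearIndependent_of_inner_eq_zero S.g hv0 hw0 hvw)
  rw [S.sectionalCurvature_eq hS, hff, hXf, S.curv_f_of_const hS hc x hX hv0,
    div_eq_iff (by simpa using hqX.ne')] at k1
  have h4 := S.four_mul_curv hS hc hs x hX hY hv0
  rw [S.sectionalCurvature_eq hS, hvw, div_eq_iff (by simpa using ⟨hqX.ne', hqY.ne'⟩)] at k2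
  rw [k2, hvw, hXfY] at h4
  have e1 : c = k := by
    apply mul_right_cancel₀ (b := S.g.inner x (X x) (X x) ^ 2) (pow_pos hqX 2).ne'
    linarith
  have e2 : 4 * k = c + 3 * s := by
    apply mul_right_cancel₀ (b := S.g.inner x (X x) (X x) * S.g.inner x (Y x) (Y x))
      (mul_pos hqX hqY).ne'
    linarith
  linarith

end MetricFStructure

end SSpaceForm
end SGeometry

theorem mainTheorem2 (n s : ℕ) (hn : 2 ≤ n) (hs : 1 ≤ s)
    {M : Type*} [TopologicalSpace M] [T2Space M] [SecondCountableTopology M] [Nonempty M]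
    [ChartedSpace (EuclideanSpace ℝ (Fin (2 * n + s))) M]
    [IsManifold (𝓡 (2 * n + s)) ∞ M]
    (S : SGeometry.MetricFStructure s
      (𝓡 (2 * n + s)) M)
    (hS : S.IsSStructure n) (c : ℝ) (hc : S.HasConstantFSectionalCurvature c) :
    (S.HasConstantLSectionalCurvature c ↔ c = s) ∧
      ((∃ k : ℝ, S.HasConstantLSectionalCurvature k) ↔ c = s) := by
  have h1 : c = s → S.HasConstantLSectionalCurvature c :=
    S.hasConstantLSectionalCurvature_of_eq hS hc hs
  have h2 (k : ℝ) (hk : S.HasConstantLSectionalCurvature k) : c = s :=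
    S.eq_of_hasConstantLSectionalCurvature hS hc hs
      -- n ≥ 2 enters here, as s + 2 < 2n + s.
      (by rw [finrank_euclideanSpace, Fintype.card_fin]; omega) hk
  exact ⟨⟨h2 c, h1⟩, fun ⟨k, hk⟩ ↦ h2 k hk, fun h ↦ ⟨c, h1 h⟩⟩
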